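/- For $r>0$ let $\gamma_r := (\mathbb{E}\,|g|^r)^{1/r}$, where $g$ is a standard Gaussian. Let $1\le p^*<2$ and $1\le q<2$, and put $a:=p^*-1$, $b:=q-1$, so that $a,b\in[0,1)$. For $\rho\in[-1,1]$ define \[ f_{a,b}(\rho) := \frac{1}{\gamma_{p^*}^{p^*}\,\gamma_q^{q}}\;\mathbb{E}\big[\operatorname{sgn}(g_1)|g_1|^{b}\,\operatorname{sgn}(g_2)|g_2|^{a}\big],\qquad g_1=\rho\, g_2+\sqrt{1-\rho^2}\,g_3, \] where $g_2,g_3$ are independent standard Gaussians. Then $f_{a,b}$ is strictly increasing on $[-1,1]$, the image $f_{a,b}([-1,1])$ contains a neighbourhood of $0$, and the inverse function $f_{a,b}^{-1}$, defined on this image, is real analytic at $0$. Writing $f^{-1}_k$ for the $k$-th Taylor coefficient of $f_{a,b}^{-1}$ at $0$, there exists $\varepsilon>0$ (depending on $p^*$ and $q$ but not on $k$) such that for every integer $k\ge 1$ \[ |f^{-1}_k| \;\le\; \frac{6.1831}{k\,(1+\varepsilon)^k}. \] -/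

import Mathlib

open MeasureTheory ProbabilityTheory Set

noncomputable section

/-- The `r`-th Gaussian norm `γ_r = (E |g|^r)^(1/r)` of a standard Gaussian `g`. -/
def gaussianNorm (r : ℝ) : ℝ :=
  (∫ x : ℝ, |x| ^ r ∂(gaussianReal 0 1)) ^ (1 / r)

/-- `E [sgn(g₁) |g₁|^b sgn(g₂) |g₂|^a]` for `ρ`-correlated standard Gaussians, where
`g₁ = ρ g₂ + √(1 - ρ²) g₃` with `(g₂, g₃) = (w.1, w.2)` standard Gaussian in the plane. -/
def holderCorr (a b ρ : ℝ) : ℝ :=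
  ∫ w : ℝ × ℝ,
    (Real.sign (ρ * w.1 + √(1 - ρ ^ 2) * w.2) * |ρ * w.1 + √(1 - ρ ^ 2) * w.2| ^ b) *
      (Real.sign w.1 * |w.1| ^ a)
    ∂((gaussianReal 0 1).prod (gaussianReal 0 1))

/-- The normalized correlation function `f_{a,b}`; with `a = p* - 1`, `b = q - 1` the normalization
is by `γ_{p*}^{p*} γ_q^q`. It is meaningful for `ρ ∈ [-1, 1]`. -/
def normHolderCorr (a b ρ : ℝ) : ℝ :=
  holderCorr a b ρ / (gaussianNorm (a + 1) ^ (a + 1) * gaussianNorm (b + 1) ^ (b + 1))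

/-- The inverse of `f_{a,b} : [-1, 1] → ℝ`, meaningful on the image `f_{a,b}([-1, 1])`. -/
def normHolderCorrInv (a b : ℝ) : ℝ → ℝ :=
  Function.invFunOn (normHolderCorr a b) (Icc (-1) 1)

/-- The `k`-th Taylor coefficient at `0` of the inverse function `f_{a,b}⁻¹`. -/
def invTaylorCoeff (a b : ℝ) (k : ℕ) : ℝ :=
  iteratedDeriv k (normHolderCorrInv a b) 0 / (Nat.factorial k : ℝ)

end

/-! Put `a = 1 - 2α`, `b = 1 - 2β` with `0 < α, β ≤ 1/2`. Writing `sgn x |x|^b` as a superposition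
over `l` of the functions `x exp(-l x²/2)` makes all Gaussian integrals explicit, and `f(ρ)` becomes
`ρ` times the mean of `(1 - t ρ²)^(-α)`, `t = l/(1+l)`, for a probability weight in `l`
(`normHolderCorr_eq`); this is `ρ ₂F₁(α, β; 3/2; ρ²)`. The same formula defines a holomorphic `F`
(`corrExt`) on the plane cut along `(-∞, -1]` and `[1, ∞)`.

Since `α ≤ 1/2`, the kernel has positive real part on the cut plane. Integration by parts in `l`
exhibits `F'` as another average of the same kernels, so `Re F' > 0`. Together with the fact that
`Im F` has the sign of `Im z`, this makes `F` injective (`injOn_corrExt`).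

Three lower bounds finish the geometry: `|F'| ≥ 2/9` for `|z| ≤ 3`, `|F| > 1.06` on `|z| = 3`, and
`|F| > R` near the cuts for some `R > 1`. By connectedness `F` maps the part of the cut plane in
`|z| < 3` onto a set containing the disc of radius `R`, so the inverse `G` is holomorphic there with
`|G'| ≤ 9/2`. Cauchy's estimate for `G'`, rather than `G`, on a circle of radius `r ∈ (1, R)` yields
`(9/2) r / (k r^k)`, with the factor `1/k`; and `4.5 · 1.06 < 6.1831`. -/

/-! ### Gaussian integrals and the integral representation -/

theorem integrableOn_rpow_mul_one_add_rpow {p r : ℝ} (hp : -1 < p) (hr : r ≤ 0)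
    (h : p + r < -1) : IntegrableOn (fun x : ℝ => x ^ p * (1 + x) ^ r) (Ioi 0) := by
  have hmeas : ∀ s : Set ℝ, AEStronglyMeasurable (fun x : ℝ => x ^ p * (1 + x) ^ r)
      (volume.restrict s) := fun s =>
    ((measurable_id.pow_const p).mul ((measurable_const.add measurable_id).pow_const r)).aestronglyMeasurable
  rw [← Ioc_union_Ioi_eq_Ioi (zero_le_one' ℝ), integrableOn_union]
  constructor
  · have h1 : IntegrableOn (fun x : ℝ => x ^ p) (Ioc 0 1) := by
      have := (intervalIntegral.intervalIntegrable_rpow' hp (a := 0) (b := 1))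
      rwa [intervalIntegrable_iff_integrableOn_Ioc_of_le zero_le_one] at this
    refine Integrable.mono' h1 (hmeas _) ?_
    filter_upwards [ae_restrict_mem measurableSet_Ioc] with x hx
    have h0 : 0 ≤ x ^ p := Real.rpow_nonneg hx.1.le _
    have h2 : (1 + x) ^ r ≤ 1 := Real.rpow_le_one_of_one_le_of_nonpos (by linarith [hx.1]) hr
    have h3 : 0 ≤ (1 + x) ^ r := Real.rpow_nonneg (by linarith [hx.1]) _
    rw [Real.norm_of_nonneg (mul_nonneg h0 h3)]
    exact mul_le_of_le_one_right h0 h2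
  · refine Integrable.mono' (integrableOn_Ioi_rpow_of_lt h one_pos) (hmeas _) ?_
    filter_upwards [ae_restrict_mem measurableSet_Ioi] with x hx
    have hx0 : 0 < x := lt_trans one_pos hx
    have h2 : (1 + x) ^ r ≤ x ^ r := Real.rpow_le_rpow_of_nonpos hx0 (by linarith) hr
    have h3 : 0 ≤ (1 + x) ^ r := Real.rpow_nonneg (by linarith) _
    rw [Real.norm_of_nonneg (mul_nonneg (Real.rpow_nonneg hx0.le _) h3), Real.rpow_add hx0]
    exact mul_le_mul_of_nonneg_left h2 (Real.rpow_nonneg hx0.le _)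

/-- The Gamma integral in `l` produces `|x|^(-2β)`, and the extra factor `x` supplies the sign and
one more power. This linearises the odd power into functions with explicit Gaussian expectation. -/
theorem integral_rpow_mul_self_mul_exp {β b : ℝ} (hβ : 0 < β) (hb : b = 1 - 2 * β) (x : ℝ) :
    ∫ l in Ioi (0 : ℝ), l ^ (β - 1) * (x * Real.exp (-(l * x ^ 2 / 2))) =
      2 ^ β * Real.Gamma β * (Real.sign x * |x| ^ b) := by
  rcases eq_or_ne x 0 with rfl | hx
  · simp
  have hx2 : 0 < x ^ 2 / 2 := by positivity
  have h := Real.integral_rpow_mul_exp_neg_mul_Ioi hβ hx2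
  have e : ∀ l : ℝ, l ^ (β - 1) * (x * Real.exp (-(l * x ^ 2 / 2))) =
      x * (l ^ (β - 1) * Real.exp (-(x ^ 2 / 2 * l))) := fun l => by
    rw [show l * x ^ 2 / 2 = x ^ 2 / 2 * l by ring]; ring
  simp_rw [e]
  rw [integral_const_mul, h]
  have hax : 0 < |x| := abs_pos.mpr hx
  have h1 : (1 / (x ^ 2 / 2)) ^ β = 2 ^ β * |x| ^ (-(2 * β)) := by
    rw [one_div_div, Real.div_rpow (by norm_num) (sq_nonneg x), ← sq_abs, Real.rpow_neg hax.le,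
      Real.rpow_mul hax.le, div_eq_mul_inv]
    norm_num
  have h2 : |x| ^ b = |x| * |x| ^ (-(2 * β)) := by
    rw [hb, sub_eq_add_neg, Real.rpow_add hax, Real.rpow_one]
  have h3 : Real.sign x * |x| = x := by
    rcases lt_or_gt_of_ne hx with h | h
    · rw [Real.sign_of_neg h, abs_of_neg h]; ring
    · rw [Real.sign_of_pos h, abs_of_pos h]; ring
  rw [h1, h2]
  linear_combination (-(2 ^ β * Real.Gamma β * |x| ^ (-(2 * β)))) * h3

theorem integral_gaussianReal_std (f : ℝ → ℝ) :
    ∫ x, f x ∂(gaussianReal 0 1) = (√(2 * Real.pi))⁻¹ * ∫ x, Real.exp (-(x ^ 2 / 2)) * f x := by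
  rw [integral_gaussianReal_eq_integral_smul one_ne_zero, ← integral_const_mul]
  congr 1 with x
  simp [gaussianPDFReal, mul_assoc, neg_div]

theorem integral_affine_mul_exp_gaussianReal {l : ℝ} (hl : 0 ≤ l) (m s : ℝ) :
    ∫ y, (m + s * y) * Real.exp (-(l * (m + s * y) ^ 2 / 2)) ∂(gaussianReal 0 1) =
      m * (1 + l * s ^ 2) ^ (-(3 / 2) : ℝ) *
        Real.exp (-(l * m ^ 2 / (2 * (1 + l * s ^ 2)))) := by
  set c := 1 + l * s ^ 2 with hc
  have hc0 : 0 < c := by positivity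
  -- Completing the square: the total exponent is maximal at `y = -l s m / c`.
  rw [integral_gaussianReal_std, ← integral_sub_right_eq_self _ (l * s * m / c)]
  have e : ∀ u : ℝ, Real.exp (-((u - l * s * m / c) ^ 2 / 2)) * ((m + s * (u - l * s * m / c)) *
      Real.exp (-(l * (m + s * (u - l * s * m / c)) ^ 2 / 2))) =
      Real.exp (-(l * m ^ 2 / (2 * c))) * (m / c * Real.exp (-(c / 2) * u ^ 2) +
        s * (u * Real.exp (-(c / 2) * u ^ 2))) := fun u => by
    have h1 : -((u - l * s * m / c) ^ 2 / 2) + -(l * (m + s * (u - l * s * m / c)) ^ 2 / 2) =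
        -(l * m ^ 2 / (2 * c)) + -(c / 2) * u ^ 2 := by
      field_simp
      rw [hc]; ring
    have h2 : m + s * (u - l * s * m / c) = m / c + s * u := by
      field_simp
      rw [hc]; ring
    calc _ = (m + s * (u - l * s * m / c)) * (Real.exp (-((u - l * s * m / c) ^ 2 / 2)) *
          Real.exp (-(l * (m + s * (u - l * s * m / c)) ^ 2 / 2))) := by ring
      _ = _ := by rw [← Real.exp_add, h1, Real.exp_add, h2]; ring
  have hodd : ∫ u : ℝ, u * Real.exp (-(c / 2) * u ^ 2) = 0 := by
    have h := integral_neg_eq_self (fun u : ℝ => u * Real.exp (-(c / 2) * u ^ 2)) volume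
    simp only [neg_mul, even_two, Even.neg_pow, integral_neg] at h
    simp only [neg_mul]
    linarith
  have hc2 : 0 < c / 2 := by positivity
  simp_rw [e]
  rw [integral_const_mul, integral_add ((integrable_exp_neg_mul_sq hc2).const_mul _)
    ((integrable_mul_exp_neg_mul_sq hc2).const_mul _), integral_const_mul, integral_const_mul, hodd,
    integral_gaussian]
  have h3 : √(Real.pi / (c / 2)) = √(2 * Real.pi) * c ^ (-(1 / 2) : ℝ) := by
    rw [show Real.pi / (c / 2) = 2 * Real.pi / c by field_simp, Real.sqrt_div' _ hc0.le,
      Real.rpow_neg hc0.le, ← Real.sqrt_eq_rpow, div_eq_mul_inv]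
  have h4 : c ^ (-(3 / 2) : ℝ) = c⁻¹ * c ^ (-(1 / 2) : ℝ) := by
    rw [← Real.rpow_neg_one, ← Real.rpow_add hc0]; norm_num
  have h5 : √(2 * Real.pi) ≠ 0 := by positivity
  rw [h3, h4]
  field_simp
  ring

theorem integral_abs_rpow_mul_exp_gaussianReal {κ : ℝ} (hκ : 0 ≤ κ) (r : ℝ) :
    ∫ x, |x| ^ r * Real.exp (-(κ * x ^ 2 / 2)) ∂(gaussianReal 0 1) =
      (1 + κ) ^ (-((r + 1) / 2)) * ∫ x, |x| ^ r ∂(gaussianReal 0 1) := by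
  rw [integral_gaussianReal_std, integral_gaussianReal_std]
  have hs : 0 < √(1 + κ) := by positivity
  have h := Measure.integral_comp_mul_left (fun x : ℝ => Real.exp (-(x ^ 2 / 2)) * |x| ^ r) (√(1 + κ))
  have e : ∀ x : ℝ, Real.exp (-((√(1 + κ) * x) ^ 2 / 2)) * |√(1 + κ) * x| ^ r =
      (√(1 + κ)) ^ r * (Real.exp (-(x ^ 2 / 2)) * (|x| ^ r * Real.exp (-(κ * x ^ 2 / 2)))) :=
    fun x => by
    rw [mul_pow, Real.sq_sqrt (by positivity), abs_mul, abs_of_pos hs,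
      Real.mul_rpow hs.le (abs_nonneg x),
      show -((1 + κ) * x ^ 2 / 2) = -(x ^ 2 / 2) + -(κ * x ^ 2 / 2) by ring, Real.exp_add]
    ring
  simp_rw [e] at h
  rw [integral_const_mul, smul_eq_mul, abs_of_pos (inv_pos.mpr hs)] at h
  have h2 : (1 + κ) ^ (-((r + 1) / 2)) = (√(1 + κ))⁻¹ * ((√(1 + κ)) ^ r)⁻¹ := by
    rw [← Real.rpow_neg_one, ← Real.rpow_neg hs.le, ← Real.rpow_add hs, Real.sqrt_eq_rpow,
      ← Real.rpow_mul (by positivity)]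
    congr 1; ring
  have h3 : (√(1 + κ)) ^ r ≠ 0 := (Real.rpow_pos_of_pos hs _).ne'
  rw [h2]
  field_simp at h ⊢
  linear_combination h

theorem measurable_real_sign : Measurable Real.sign := by
  unfold Real.sign
  exact Measurable.ite measurableSet_Iio measurable_const
    (Measurable.ite measurableSet_Ioi measurable_const measurable_const)

theorem abs_sign_mul_abs_rpow_le (x r : ℝ) : |Real.sign x * |x| ^ r| ≤ |x| ^ r := by
  rw [abs_mul, abs_of_nonneg (Real.rpow_nonneg (abs_nonneg x) r)]
  refine mul_le_of_le_one_left (Real.rpow_nonneg (abs_nonneg x) r) ?_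
  rcases Real.sign_apply_eq x with h | h | h <;> simp [h]

theorem rpow_le_one_add {x r : ℝ} (hx : 0 ≤ x) (h0 : 0 ≤ r) (h1 : r ≤ 1) : x ^ r ≤ 1 + x := by
  rcases le_total x 1 with h | h
  · linarith [Real.rpow_le_one hx h h0]
  · have := Real.rpow_le_rpow_of_exponent_le h h1
    rw [Real.rpow_one] at this
    linarith

theorem integrable_sq_gaussianReal_std : Integrable (fun x : ℝ => x ^ 2) (gaussianReal 0 1) := by
  have := (memLp_id_gaussianReal (μ := 0) (v := 1) 2)
  simpa using this.integrable_sq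

theorem integral_sq_gaussianReal_std : ∫ x : ℝ, x ^ 2 ∂(gaussianReal 0 1) = 1 := by
  have h := variance_id_gaussianReal (μ := 0) (v := 1)
  rw [variance_of_integral_eq_zero aemeasurable_id (by simp)] at h
  simpa using h

theorem integrable_abs_rpow_gaussianReal {r : ℝ} (h0 : 0 ≤ r) (h2 : r ≤ 2) :
    Integrable (fun x : ℝ => |x| ^ r) (gaussianReal 0 1) := by
  refine Integrable.mono' ((integrable_const 1).add integrable_sq_gaussianReal_std)
    (measurable_norm.pow_const r).aestronglyMeasurable (.of_forall fun x => ?_)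
  rw [Real.norm_of_nonneg (Real.rpow_nonneg (abs_nonneg x) r)]
  have := rpow_le_one_add (sq_nonneg x) (r := r / 2) (by linarith) (by linarith)
  rw [← sq_abs, ← Real.rpow_natCast, ← Real.rpow_mul (abs_nonneg x)] at this
  simp only [Nat.cast_ofNat, mul_div_cancel₀ r (two_ne_zero' ℝ)] at this
  simpa using this

theorem integral_abs_rpow_gaussianReal_pos {r : ℝ} (h0 : 0 ≤ r) (h2 : r ≤ 2) :
    0 < ∫ x : ℝ, |x| ^ r ∂(gaussianReal 0 1) := by
  rw [integral_pos_iff_support_of_nonneg (fun x => Real.rpow_nonneg (abs_nonneg x) r)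
    (integrable_abs_rpow_gaussianReal h0 h2)]
  have : ({0}ᶜ : Set ℝ) ⊆ Function.support fun x : ℝ => |x| ^ r := fun x hx =>
    (Real.rpow_pos_of_pos (abs_pos.mpr hx) r).ne'
  refine lt_of_lt_of_le ?_ (measure_mono this)
  have : NullSingletonClass (gaussianReal 0 1) := nullSingletonClass_gaussianReal one_ne_zero
  rw [measure_compl (measurableSet_singleton 0) (by simp), measure_singleton]
  simp

theorem integrable_abs_rpow_mul_abs_rpow {a b ρ s : ℝ} (ha0 : 0 ≤ a) (ha1 : a ≤ 1) (hb0 : 0 ≤ b)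
    (hb1 : b ≤ 1) (hρ : |ρ| ≤ 1) (hs : |s| ≤ 1) :
    Integrable (fun w : ℝ × ℝ => |ρ * w.1 + s * w.2| ^ b * |w.1| ^ a)
      ((gaussianReal 0 1).prod (gaussianReal 0 1)) := by
  have hi : Integrable (fun w : ℝ × ℝ => 3 * (1 + w.1 ^ 2 + w.2 ^ 2))
      ((gaussianReal 0 1).prod (gaussianReal 0 1)) :=
    (((integrable_const 1).add (integrable_sq_gaussianReal_std.comp_fst _)).add
      (integrable_sq_gaussianReal_std.comp_snd _)).const_mul 3
  refine Integrable.mono' hi (Measurable.aestronglyMeasurable (by fun_prop)) (.of_forall fun w => ?_)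
  rw [Real.norm_of_nonneg (by positivity)]
  have h1 := rpow_le_one_add (abs_nonneg (ρ * w.1 + s * w.2)) hb0 hb1
  have h2 := rpow_le_one_add (abs_nonneg w.1) ha0 ha1
  have h3 : |ρ * w.1 + s * w.2| ≤ |w.1| + |w.2| := by
    refine (abs_add_le _ _).trans ?_
    rw [abs_mul, abs_mul]
    gcongr
    · exact mul_le_of_le_one_left (abs_nonneg _) hρ
    · exact mul_le_of_le_one_left (abs_nonneg _) hs
  have h4 : (0 : ℝ) ≤ |w.1| ^ a := by positivity
  calc _ ≤ (1 + (|w.1| + |w.2|)) * (1 + |w.1| + |w.2|) := by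
        gcongr
        · linarith
        · linarith [abs_nonneg w.2]
    _ ≤ _ := by
        rw [← sq_abs w.1, ← sq_abs w.2]
        nlinarith [sq_nonneg (|w.1| - 1), sq_nonneg (|w.2| - 1), sq_nonneg (|w.1| - |w.2|)]

theorem integral_correlated_mul_exp {a ρ l : ℝ} (ha0 : 0 ≤ a) (ha1 : a ≤ 1) (hρ : |ρ| ≤ 1)
    (hl : 0 < l) :
    ∫ w : ℝ × ℝ, ((ρ * w.1 + √(1 - ρ ^ 2) * w.2) *
        Real.exp (-(l * (ρ * w.1 + √(1 - ρ ^ 2) * w.2) ^ 2 / 2))) * (Real.sign w.1 * |w.1| ^ a)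
        ∂((gaussianReal 0 1).prod (gaussianReal 0 1)) =
      ρ * ((1 + l) ^ (-(3 / 2) : ℝ) * (1 - ρ ^ 2 * (l / (1 + l))) ^ (-((1 - a) / 2))) *
        ∫ x, |x| ^ (a + 1) ∂(gaussianReal 0 1) := by
  have hρ2 : ρ ^ 2 ≤ 1 := (sq_le_one_iff_abs_le_one ρ).mpr hρ
  have hs1 : |√(1 - ρ ^ 2)| ≤ 1 := by
    rw [abs_of_nonneg (Real.sqrt_nonneg _), Real.sqrt_le_iff]; constructor <;> nlinarith [sq_nonneg ρ]
  have hint : Integrable (fun w : ℝ × ℝ => ((ρ * w.1 + √(1 - ρ ^ 2) * w.2) *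
        Real.exp (-(l * (ρ * w.1 + √(1 - ρ ^ 2) * w.2) ^ 2 / 2))) * (Real.sign w.1 * |w.1| ^ a))
        ((gaussianReal 0 1).prod (gaussianReal 0 1)) := by
    have hm : Measurable fun w : ℝ × ℝ => Real.sign w.1 := measurable_real_sign.comp measurable_fst
    refine Integrable.mono' (integrable_abs_rpow_mul_abs_rpow ha0 ha1 zero_le_one le_rfl hρ hs1)
      (Measurable.aestronglyMeasurable (by fun_prop)) (.of_forall fun w => ?_)
    rw [norm_mul, norm_mul, Real.norm_eq_abs, Real.norm_eq_abs, Real.norm_eq_abs, Real.rpow_one,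
      Real.abs_exp]
    refine mul_le_mul (mul_le_of_le_one_right (abs_nonneg _) ?_) (abs_sign_mul_abs_rpow_le _ _)
      (abs_nonneg _) (abs_nonneg _)
    rw [Real.exp_le_one_iff]
    have : 0 ≤ l * (ρ * w.1 + √(1 - ρ ^ 2) * w.2) ^ 2 / 2 := by positivity
    linarith
  rw [integral_prod _ hint]
  simp_rw [integral_mul_const, integral_affine_mul_exp_gaussianReal hl.le]
  rw [Real.sq_sqrt (by linarith)]
  set c := 1 + l * (1 - ρ ^ 2) with hc
  have hc0 : 0 < c := by nlinarith
  have e : ∀ x : ℝ, ρ * x * c ^ (-(3 / 2) : ℝ) * Real.exp (-(l * (ρ * x) ^ 2 / (2 * c))) *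
      (Real.sign x * |x| ^ a) = ρ * c ^ (-(3 / 2) : ℝ) *
        (|x| ^ (a + 1) * Real.exp (-(l * ρ ^ 2 / c * x ^ 2 / 2))) := fun x => by
    have h1 : |x| ^ (a + 1) = |x| ^ a * |x| := by
      rcases eq_or_ne x 0 with rfl | hx
      · simp [Real.zero_rpow (show a + 1 ≠ 0 by linarith)]
      · rw [Real.rpow_add (abs_pos.mpr hx), Real.rpow_one]
    have h2 : x * Real.sign x = |x| := by
      rcases lt_trichotomy x 0 with h | h | h
      · rw [Real.sign_of_neg h, abs_of_neg h]; ring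
      · simp [h]
      · rw [Real.sign_of_pos h, abs_of_pos h]; ring
    rw [h1, ← h2, show l * (ρ * x) ^ 2 / (2 * c) = l * ρ ^ 2 / c * x ^ 2 / 2 by field_simp]
    ring
  simp_rw [e]
  rw [integral_const_mul, integral_abs_rpow_mul_exp_gaussianReal (by positivity)]
  have h1l : 0 < 1 + l := by linarith
  have h3 : 1 + l * ρ ^ 2 / c = (1 + l) * c⁻¹ := by field_simp; rw [hc]; ring
  have h4 : 1 - ρ ^ 2 * (l / (1 + l)) = c * (1 + l)⁻¹ := by field_simp; rw [hc]; ring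
  -- The powers of `c` combine to `-3/2 + (a+2)/2 = -(1-a)/2`, which is `-α`.
  have h5 : c ^ (-(3 / 2) : ℝ) * ((1 + l) * c⁻¹) ^ (-((a + 1 + 1) / 2)) =
      (1 + l) ^ (-(3 / 2) : ℝ) * (c * (1 + l)⁻¹) ^ (-((1 - a) / 2)) := by
    rw [Real.mul_rpow h1l.le (by positivity), Real.mul_rpow hc0.le (by positivity),
      Real.inv_rpow hc0.le, Real.inv_rpow h1l.le, ← Real.rpow_neg hc0.le, ← Real.rpow_neg h1l.le,
      mul_left_comm, ← Real.rpow_add hc0, mul_left_comm ((1 + l) ^ _), ← Real.rpow_add h1l, mul_comm]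
    congr 2 <;> ring
  rw [h3, h4, ← h5]
  ring

/-- Fubini between the `l`-integral and the Gaussian plane. -/
theorem gamma_mul_holderCorr {a b β ρ : ℝ} (ha0 : 0 ≤ a) (ha1 : a ≤ 1) (hβ : 0 < β)
    (hβ' : β ≤ 1 / 2) (hb : b = 1 - 2 * β) (hρ : |ρ| ≤ 1) :
    2 ^ β * Real.Gamma β * holderCorr a b ρ =
      ρ * (∫ x, |x| ^ (a + 1) ∂(gaussianReal 0 1)) *
        ∫ l in Ioi (0 : ℝ), l ^ (β - 1) * (1 + l) ^ (-(3 / 2) : ℝ) *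
          (1 - ρ ^ 2 * (l / (1 + l))) ^ (-((1 - a) / 2)) := by
  have hρ2 : ρ ^ 2 ≤ 1 := (sq_le_one_iff_abs_le_one ρ).mpr hρ
  have hs1 : |√(1 - ρ ^ 2)| ≤ 1 := by
    rw [abs_of_nonneg (Real.sqrt_nonneg _), Real.sqrt_le_iff]; constructor <;> nlinarith [sq_nonneg ρ]
  have hG : 0 < 2 ^ β * Real.Gamma β := mul_pos (by positivity) (Real.Gamma_pos_of_pos hβ)
  set Φ : ℝ × ℝ → ℝ → ℝ := fun w l => l ^ (β - 1) * ((ρ * w.1 + √(1 - ρ ^ 2) * w.2) *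
        Real.exp (-(l * (ρ * w.1 + √(1 - ρ ^ 2) * w.2) ^ 2 / 2))) * (Real.sign w.1 * |w.1| ^ a)
    with hΦ
  have hmeas : Measurable (Function.uncurry Φ) := by
    have hm : Measurable fun w : (ℝ × ℝ) × ℝ => Real.sign w.1.1 :=
      measurable_real_sign.comp (measurable_fst.comp measurable_fst)
    simp only [hΦ, Function.uncurry_def]
    fun_prop
  -- The norm is the same integrand taken at the absolute values, so the Gamma formula also
  -- evaluates its `l`-integral and gives absolute integrability.
  have hnorm : ∀ w : ℝ × ℝ, ∀ l ∈ Ioi (0 : ℝ), ‖Φ w l‖ = l ^ (β - 1) *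
      (|ρ * w.1 + √(1 - ρ ^ 2) * w.2| *
        Real.exp (-(l * |ρ * w.1 + √(1 - ρ ^ 2) * w.2| ^ 2 / 2))) *
        |Real.sign w.1 * |w.1| ^ a| := fun w l hl => by
    simp only [hΦ, norm_mul, Real.norm_eq_abs, Real.abs_exp, sq_abs, abs_mul,
      abs_of_nonneg (Real.rpow_nonneg (le_of_lt hl) (β - 1))]
  have hslice : ∀ x : ℝ, IntegrableOn (fun l : ℝ => l ^ (β - 1) *
      (x * Real.exp (-(l * x ^ 2 / 2)))) (Ioi 0) := fun x => by
    rcases eq_or_ne x 0 with rfl | hx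
    · simp
    have h := (integrableOn_rpow_mul_exp_neg_mul_rpow (s := β - 1) (p := 1) (b := x ^ 2 / 2)
      (by linarith) one_pos (by positivity)).const_mul x
    refine IntegrableOn.congr_fun h (fun l _ => ?_) measurableSet_Ioi
    simp only [Real.rpow_one]
    rw [show -(x ^ 2 / 2) * l = -(l * x ^ 2 / 2) by ring]; ring
  have hint : Integrable (Function.uncurry Φ)
      (((gaussianReal 0 1).prod (gaussianReal 0 1)).prod (volume.restrict (Ioi 0))) := by
    rw [integrable_prod_iff hmeas.aestronglyMeasurable]
    constructor
    · exact .of_forall fun w => (hslice (ρ * w.1 + √(1 - ρ ^ 2) * w.2)).mul_const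
        (Real.sign w.1 * |w.1| ^ a)
    · have e : ∀ w : ℝ × ℝ, ∫ l in Ioi (0 : ℝ), ‖Function.uncurry Φ (w, l)‖ =
          2 ^ β * Real.Gamma β * (Real.sign |ρ * w.1 + √(1 - ρ ^ 2) * w.2| *
            |ρ * w.1 + √(1 - ρ ^ 2) * w.2| ^ b) * |Real.sign w.1 * |w.1| ^ a| := fun w => by
        rw [setIntegral_congr_fun (f := fun l => ‖Function.uncurry Φ (w, l)‖) measurableSet_Ioi
          (hnorm w), integral_mul_const,
          integral_rpow_mul_self_mul_exp hβ hb, abs_abs]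
      simp_rw [e]
      have hm : Measurable fun w : ℝ × ℝ => Real.sign w.1 := measurable_real_sign.comp measurable_fst
      have hm' : Measurable fun w : ℝ × ℝ => Real.sign |ρ * w.1 + √(1 - ρ ^ 2) * w.2| :=
        measurable_real_sign.comp (by fun_prop)
      refine Integrable.mono' ((integrable_abs_rpow_mul_abs_rpow (b := b) ha0 ha1 (by linarith)
        (by linarith) hρ hs1).const_mul (2 ^ β * Real.Gamma β))
        (Measurable.aestronglyMeasurable (by fun_prop)) (.of_forall fun w => ?_)
      rw [norm_mul, norm_mul, Real.norm_of_nonneg hG.le, Real.norm_eq_abs, Real.norm_eq_abs, abs_abs,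
        mul_assoc]
      refine mul_le_mul_of_nonneg_left (mul_le_mul ?_ (abs_sign_mul_abs_rpow_le _ _) (abs_nonneg _)
        (by positivity)) hG.le
      simpa using abs_sign_mul_abs_rpow_le |ρ * w.1 + √(1 - ρ ^ 2) * w.2| b
  have hswap := integral_integral_swap hint
  have h1 : ∀ w : ℝ × ℝ, ∫ l in Ioi (0 : ℝ), Φ w l = 2 ^ β * Real.Gamma β *
      ((Real.sign (ρ * w.1 + √(1 - ρ ^ 2) * w.2) * |ρ * w.1 + √(1 - ρ ^ 2) * w.2| ^ b) *
      (Real.sign w.1 * |w.1| ^ a)) := fun w => by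
    simp only [hΦ]
    rw [integral_mul_const, integral_rpow_mul_self_mul_exp hβ hb, mul_assoc]
  have h2 : ∀ l ∈ Ioi (0 : ℝ), ∫ w, Φ w l ∂((gaussianReal 0 1).prod (gaussianReal 0 1)) =
      ρ * (∫ x, |x| ^ (a + 1) ∂(gaussianReal 0 1)) * (l ^ (β - 1) * (1 + l) ^ (-(3 / 2) : ℝ) *
          (1 - ρ ^ 2 * (l / (1 + l))) ^ (-((1 - a) / 2))) := fun l hl => by
    simp only [hΦ, mul_assoc (l ^ (β - 1))]
    rw [integral_const_mul, integral_correlated_mul_exp ha0 ha1 hρ hl]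
    ring
  rw [setIntegral_congr_fun measurableSet_Ioi h2, integral_const_mul] at hswap
  simp_rw [h1] at hswap
  rw [integral_const_mul] at hswap
  exact hswap

theorem gaussianNorm_rpow {r : ℝ} (h0 : 0 < r) :
    gaussianNorm r ^ r = ∫ x : ℝ, |x| ^ r ∂(gaussianReal 0 1) := by
  rw [gaussianNorm, ← Real.rpow_mul (integral_nonneg fun x => Real.rpow_nonneg (abs_nonneg x) r),
    one_div_mul_cancel h0.ne', Real.rpow_one]

theorem holderCorr_one_one {b : ℝ} (hb : 0 ≤ b) :
    holderCorr 1 b 1 = ∫ x : ℝ, |x| ^ (b + 1) ∂(gaussianReal 0 1) := by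
  have e : ∀ w : ℝ × ℝ, (Real.sign (1 * w.1 + √(1 - 1 ^ 2) * w.2) *
      |1 * w.1 + √(1 - 1 ^ 2) * w.2| ^ b) * (Real.sign w.1 * |w.1| ^ (1 : ℝ)) = |w.1| ^ (b + 1) :=
    fun w => by
    rcases eq_or_ne w.1 0 with h | h
    · simp [h, Real.zero_rpow (show b + 1 ≠ 0 by linarith)]
    · have h2 : Real.sign w.1 * Real.sign w.1 = 1 := by
        rcases Real.sign_apply_eq_of_ne_zero _ h with h | h <;> simp [h]
      rw [Real.rpow_add (abs_pos.mpr h)]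
      simp only [one_pow, sub_self, Real.sqrt_zero, zero_mul, add_zero, one_mul, Real.rpow_one]
      linear_combination |w.1| ^ b * |w.1| * h2
  rw [holderCorr]
  simp_rw [e]
  rw [integral_fun_fst (fun x : ℝ => |x| ^ (b + 1))]
  simp

/-- Integral representation of the normalized correlation function. -/
theorem normHolderCorr_eq {a b α β ρ : ℝ} (ha0 : 0 ≤ a) (ha1 : a ≤ 1) (hα : a = 1 - 2 * α)
    (hβ : 0 < β) (hβ' : β ≤ 1 / 2) (hb : b = 1 - 2 * β) (hρ : |ρ| ≤ 1) :
    normHolderCorr a b ρ = ρ * (∫ l in Ioi (0 : ℝ), l ^ (β - 1) * (1 + l) ^ (-(3 / 2) : ℝ) *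
          (1 - ρ ^ 2 * (l / (1 + l))) ^ (-α)) /
        ∫ l in Ioi (0 : ℝ), l ^ (β - 1) * (1 + l) ^ (-(3 / 2) : ℝ) := by
  have hG : 0 < 2 ^ β * Real.Gamma β := mul_pos (by positivity) (Real.Gamma_pos_of_pos hβ)
  have hα' : (1 - a) / 2 = α := by linarith
  have h1 := gamma_mul_holderCorr ha0 ha1 hβ hβ' hb hρ
  -- The instance `a = 1`, `ρ = 1` evaluates `E |g|^(b+1)` through the total mass of the weight, so
  -- no Beta function is needed for the normalization.
  have h2 := gamma_mul_holderCorr zero_le_one le_rfl hβ hβ' hb (ρ := 1) (by simp)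
  rw [holderCorr_one_one (by linarith)] at h2
  have h3 : ∫ x : ℝ, |x| ^ ((1 : ℝ) + 1) ∂(gaussianReal 0 1) = 1 := by
    simp only [one_add_one_eq_two, Real.rpow_two, sq_abs, integral_sq_gaussianReal_std]
  simp only [h3, sub_self, zero_div, neg_zero, Real.rpow_zero, mul_one] at h2
  have hB := integral_abs_rpow_gaussianReal_pos (r := b + 1) (by linarith) (by linarith)
  have hA := integral_abs_rpow_gaussianReal_pos (r := a + 1) (by linarith) (by linarith)
  rw [hα'] at h1
  rw [normHolderCorr, gaussianNorm_rpow (by linarith), gaussianNorm_rpow (by linarith), one_mul] at *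
  rw [← h2]
  rw [div_eq_div_iff (mul_pos hA hB).ne' (mul_pos hG hB).ne']
  linear_combination (∫ x : ℝ, |x| ^ (b + 1) ∂(gaussianReal 0 1)) * h1

/-! ### The doubly slit plane and the Euler kernel -/

/-- The complex plane without the rays `(-∞, -1]` and `[1, ∞)`. -/
def doublySlitPlane : Set ℂ := {z | z.im ≠ 0 ∨ |z.re| < 1}

theorem isOpen_doublySlitPlane : IsOpen doublySlitPlane :=
  (isOpen_ne_fun Complex.continuous_im continuous_const).union
    (isOpen_lt Complex.continuous_re.abs continuous_const)

theorem zero_mem_doublySlitPlane : (0 : ℂ) ∈ doublySlitPlane := by simp [doublySlitPlane]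

theorem neg_mem_doublySlitPlane {z : ℂ} (hz : z ∈ doublySlitPlane) : -z ∈ doublySlitPlane := by
  simpa [doublySlitPlane] using hz

theorem conj_mem_doublySlitPlane {z : ℂ} (hz : z ∈ doublySlitPlane) :
    (starRingEnd ℂ) z ∈ doublySlitPlane := by
  simpa [doublySlitPlane] using hz

theorem one_sub_mul_sq_mem_slitPlane {z : ℂ} (hz : z ∈ doublySlitPlane) {t : ℝ}
    (ht : t ∈ Icc (0 : ℝ) 1) : 1 - (t : ℂ) * z ^ 2 ∈ Complex.slitPlane := by
  rw [Complex.mem_slitPlane_iff]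
  have hre : (1 - (t : ℂ) * z ^ 2).re = 1 - t * (z.re ^ 2 - z.im ^ 2) := by
    simp [pow_two]
  have him : (1 - (t : ℂ) * z ^ 2).im = -(2 * t * (z.re * z.im)) := by
    simp [pow_two]; ring
  rw [hre, him]
  by_contra! h
  obtain ⟨h1, h2⟩ := h
  have h3 : t * (z.re * z.im) = 0 := by linarith
  rcases mul_eq_zero.mp h3 with h | h
  · rw [h] at h1; norm_num at h1
  rcases mul_eq_zero.mp h with h | h
  · rw [h] at h1; nlinarith [ht.1, mul_nonneg ht.1 (sq_nonneg z.im)]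
  · rcases hz with hz | hz
    · exact hz h
    · have : z.re ^ 2 < 1 := (sq_lt_one_iff_abs_lt_one _).mpr hz
      rw [h] at h1; nlinarith [ht.1, ht.2, sq_nonneg z.re]

/-- The Euler kernel `(1 - t z²)^(-α)`. -/
noncomputable def eulerKernel (α t : ℝ) (z : ℂ) : ℂ := (1 - (t : ℂ) * z ^ 2) ^ ((-α : ℝ) : ℂ)

theorem norm_eulerKernel (α t : ℝ) (z : ℂ) :
    ‖eulerKernel α t z‖ = ‖1 - (t : ℂ) * z ^ 2‖ ^ (-α) := Complex.norm_cpow_real _ _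

/-- Off the slits `|arg(1 - t z²)| < π`, and the exponent multiplies the argument by `-α` with `α ≤
1/2`, leaving it inside `(-π/2, π/2)`. -/
theorem re_eulerKernel_pos {α t : ℝ} {z : ℂ} (hα0 : 0 < α) (hα : α ≤ 1 / 2)
    (hz : z ∈ doublySlitPlane) (ht : t ∈ Icc (0 : ℝ) 1) : 0 < (eulerKernel α t z).re := by
  have hs := one_sub_mul_sq_mem_slitPlane hz ht
  rw [eulerKernel, Complex.cpow_ofReal_re]
  refine mul_pos (Real.rpow_pos_of_pos (norm_pos_iff.mpr (Complex.slitPlane_ne_zero hs)) _)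
    (Real.cos_pos_of_mem_Ioo ?_)
  have h1 := Complex.neg_pi_lt_arg (1 - (t : ℂ) * z ^ 2)
  have h2 : (1 - (t : ℂ) * z ^ 2).arg < Real.pi :=
    lt_of_le_of_ne (Complex.arg_le_pi _) (Complex.mem_slitPlane_iff_arg.mp hs).1
  have h3 : α * Real.pi ≤ 1 / 2 * Real.pi := mul_le_mul_of_nonneg_right hα Real.pi_pos.le
  constructor <;> nlinarith

/-- With `z = x + iy`, `Im(1 - t z²) = -2txy`, and the negative exponent reverses the sign of the
argument. The sign obtained does not depend on `t`, so imaginary parts cannot cancel in an average.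
-/
theorem re_mul_im_mul_im_eulerKernel_nonneg {α t : ℝ} {z : ℂ} (hα0 : 0 < α) (hα : α ≤ 1 / 2)
    (ht : t ∈ Icc (0 : ℝ) 1) : 0 ≤ z.re * z.im * (eulerKernel α t z).im := by
  have him : (1 - (t : ℂ) * z ^ 2).im = -(2 * t * (z.re * z.im)) := by
    simp [pow_two]; ring
  have hn : 0 ≤ ‖1 - (t : ℂ) * z ^ 2‖ ^ (-α) := Real.rpow_nonneg (norm_nonneg _) _
  have h1 := Complex.neg_pi_lt_arg (1 - (t : ℂ) * z ^ 2)
  have h2 := Complex.arg_le_pi (1 - (t : ℂ) * z ^ 2)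
  rw [eulerKernel, Complex.cpow_ofReal_im]
  have hp := Real.pi_pos
  rcases lt_trichotomy (z.re * z.im * t) 0 with h | h | h
  · have h4 : 0 ≤ (1 - (t : ℂ) * z ^ 2).arg := Complex.arg_nonneg_iff.mpr (by rw [him]; nlinarith)
    have hxy : z.re * z.im ≤ 0 := by
      by_contra! h5; nlinarith [mul_nonneg h5.le ht.1]
    refine mul_nonneg_of_nonpos_of_nonpos hxy (mul_nonpos_of_nonneg_of_nonpos hn
      (Real.sin_nonpos_of_nonpos_of_neg_pi_le ?_ ?_)) <;> nlinarith
  · have h6 : t = 0 ∨ z.re * z.im = 0 := by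
      rcases mul_eq_zero.mp h with h | h
      · exact .inr h
      · exact .inl h
    rcases h6 with h6 | h6 <;> simp [h6]
  · have hxy : 0 ≤ z.re * z.im := by
      by_contra! h5; nlinarith [mul_nonneg (neg_pos.mpr h5).le ht.1]
    have h4 : (1 - (t : ℂ) * z ^ 2).arg < 0 := Complex.arg_neg_iff.mpr (by rw [him]; nlinarith)
    refine mul_nonneg hxy (mul_nonneg hn (Real.sin_nonneg_of_nonneg_of_le_pi ?_ ?_)) <;> nlinarith

theorem continuousOn_eulerKernel (α : ℝ) {z : ℂ} (hz : z ∈ doublySlitPlane) :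
    ContinuousOn (fun t : ℝ => eulerKernel α t z) (Icc 0 1) := by
  refine ContinuousOn.cpow (by fun_prop) continuousOn_const fun t ht =>
    one_sub_mul_sq_mem_slitPlane hz ht

theorem eulerKernel_zero (α t : ℝ) : eulerKernel α t 0 = 1 := by simp [eulerKernel]

theorem eulerKernel_neg (α t : ℝ) (z : ℂ) : eulerKernel α t (-z) = eulerKernel α t z := by
  simp [eulerKernel]

theorem eulerKernel_conj (α : ℝ) {t : ℝ} {z : ℂ} (hz : z ∈ doublySlitPlane)
    (ht : t ∈ Icc (0 : ℝ) 1) :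
    eulerKernel α t ((starRingEnd ℂ) z) = (starRingEnd ℂ) (eulerKernel α t z) := by
  have h := Complex.cpow_conj (1 - (t : ℂ) * z ^ 2) ((-α : ℝ) : ℂ)
    (Complex.mem_slitPlane_iff_arg.mp (one_sub_mul_sq_mem_slitPlane hz ht)).1
  rw [Complex.conj_ofReal] at h
  rw [eulerKernel, eulerKernel, h, Complex.conj_conj]
  simp

theorem eulerKernel_ofReal (α : ℝ) {t x : ℝ} (hx : |x| ≤ 1) (ht : t ∈ Icc (0 : ℝ) 1) :
    eulerKernel α t x = ((1 - x ^ 2 * t) ^ (-α) : ℝ) := by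
  have : x ^ 2 ≤ 1 := (sq_le_one_iff_abs_le_one _).mpr hx
  rw [Complex.ofReal_cpow (by nlinarith [ht.1, ht.2]), eulerKernel]
  push_cast
  ring_nf

/-- The `z`-derivative of `z (1 - t z²)^(-α)`. -/
noncomputable def eulerKernelDeriv (α t : ℝ) (z : ℂ) : ℂ :=
  eulerKernel α t z + z * (((-α : ℝ) : ℂ) * (1 - (t : ℂ) * z ^ 2) ^ (((-α : ℝ) : ℂ) - 1) *
    (-((t : ℂ) * (2 * z))))

theorem hasDerivAt_mul_eulerKernel (α : ℝ) {t : ℝ} {z : ℂ} (hz : z ∈ doublySlitPlane)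
    (ht : t ∈ Icc (0 : ℝ) 1) :
    HasDerivAt (fun z => z * eulerKernel α t z) (eulerKernelDeriv α t z) z := by
  have h1 : HasDerivAt (fun z : ℂ => 1 - (t : ℂ) * z ^ 2) (-((t : ℂ) * (2 * z))) z := by
    simpa using ((hasDerivAt_pow 2 z).const_mul (t : ℂ)).const_sub 1
  have h2 := (hasDerivAt_id z).mul (h1.cpow_const (c := ((-α : ℝ) : ℂ))
    (one_sub_mul_sq_mem_slitPlane hz ht))
  refine h2.congr_deriv ?_
  simp [eulerKernelDeriv, eulerKernel]

theorem continuousOn_eulerKernelDeriv (α : ℝ) :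
    ContinuousOn (fun p : ℝ × ℂ => eulerKernelDeriv α p.1 p.2)
      (Icc (0 : ℝ) 1 ×ˢ doublySlitPlane) := by
  have h : ∀ c : ℂ, ContinuousOn (fun p : ℝ × ℂ => (1 - (p.1 : ℂ) * p.2 ^ 2) ^ c)
      (Icc (0 : ℝ) 1 ×ˢ doublySlitPlane) := fun c =>
    ContinuousOn.cpow (by fun_prop) continuousOn_const fun p hp =>
      one_sub_mul_sq_mem_slitPlane hp.2 hp.1
  exact (h _).add (continuous_snd.continuousOn.mul ((continuousOn_const.mul (h _)).mul
    (by fun_prop)))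

/-! ### Averages of the kernel and the holomorphic extension -/

theorem div_one_add_mem_Icc {l : ℝ} (hl : l ∈ Ici (0 : ℝ)) : l / (1 + l) ∈ Icc (0 : ℝ) 1 := by
  have : (0 : ℝ) ≤ l := hl
  exact ⟨by positivity, (div_le_one (by positivity)).mpr (by linarith)⟩

theorem continuousOn_comp_div_one_add {E : Type*} [TopologicalSpace E] {g : ℝ → E}
    (hg : ContinuousOn g (Icc 0 1)) :
    ContinuousOn (fun l : ℝ => g (l / (1 + l))) (Ici 0) := by
  refine hg.comp (ContinuousOn.div continuousOn_id (by fun_prop) fun l hl => ?_)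
    fun l hl => div_one_add_mem_Icc hl
  have : (0 : ℝ) ≤ l := hl
  positivity

theorem integrableOn_mul_comp_div_one_add {w : ℝ → ℝ} (hw : IntegrableOn w (Ioi 0)) {g : ℝ → ℂ}
    (hg : ContinuousOn g (Icc 0 1)) :
    IntegrableOn (fun l : ℝ => (w l : ℂ) * g (l / (1 + l))) (Ioi 0) := by
  obtain ⟨B, hB⟩ := isCompact_Icc.exists_bound_of_continuousOn hg
  refine Integrable.mul_bdd (c := B) hw.ofReal
    (((continuousOn_comp_div_one_add hg).mono Ioi_subset_Ici_self).aestronglyMeasurable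
      measurableSet_Ioi) ?_
  filter_upwards [ae_restrict_mem measurableSet_Ioi] with l hl
  exact hB _ (div_one_add_mem_Icc (Ioi_subset_Ici_self hl))

theorem integral_mul_le_map_integral {w c : ℝ → ℝ} (hw0 : ∀ l ∈ Ioi (0 : ℝ), 0 ≤ w l)
    (hwc : IntegrableOn (fun l => w l * c l) (Ioi 0)) {g : ℝ → ℂ}
    (hg : IntegrableOn (fun l => (w l : ℂ) * g l) (Ioi 0)) (L : ℂ →L[ℝ] ℝ)
    (h : ∀ l ∈ Ioi (0 : ℝ), c l ≤ L (g l)) :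
    ∫ l in Ioi (0 : ℝ), w l * c l ≤ L (∫ l in Ioi (0 : ℝ), (w l : ℂ) * g l) := by
  rw [← L.integral_comp_comm hg]
  refine setIntegral_mono_on hwc (L.integrable_comp hg) measurableSet_Ioi fun l hl => ?_
  rw [← Complex.real_smul, map_smul, smul_eq_mul]
  exact mul_le_mul_of_nonneg_left (h l hl) (hw0 l hl)

/-- The weight `l^(β-1) (1+l)^(-3/2)`. -/
noncomputable def corrWeight (β l : ℝ) : ℝ := l ^ (β - 1) * (1 + l) ^ (-(3 / 2) : ℝ)

theorem corrWeight_pos (β : ℝ) {l : ℝ} (hl : l ∈ Ioi (0 : ℝ)) : 0 < corrWeight β l := by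
  have : (0 : ℝ) < l := hl
  unfold corrWeight; positivity

theorem integrableOn_corrWeight {β : ℝ} (hβ : 0 < β) (hβ' : β ≤ 1 / 2) :
    IntegrableOn (corrWeight β) (Ioi 0) :=
  integrableOn_rpow_mul_one_add_rpow (by linarith) (by norm_num) (by linarith)

theorem setIntegral_Ioi_pos {w : ℝ → ℝ} (hw : IntegrableOn w (Ioi 0))
    (h : ∀ l ∈ Ioi (0 : ℝ), 0 < w l) : 0 < ∫ l in Ioi (0 : ℝ), w l := by
  rw [setIntegral_pos_iff_support_of_nonneg_ae _ hw]
  · have : Function.support w ∩ Ioi 0 = Ioi 0 := inter_eq_right.mpr fun l hl => (h l hl).ne'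
    simp [this]
  · filter_upwards [ae_restrict_mem measurableSet_Ioi] with l hl using (h l hl).le

theorem integral_corrWeight_pos {β : ℝ} (hβ : 0 < β) (hβ' : β ≤ 1 / 2) :
    0 < ∫ l in Ioi (0 : ℝ), corrWeight β l :=
  setIntegral_Ioi_pos (integrableOn_corrWeight hβ hβ') fun _ hl => corrWeight_pos β hl

/-- The average of the Euler kernel against the normalized weight. -/
noncomputable def corrAvg (α β : ℝ) (z : ℂ) : ℂ :=
  (∫ l in Ioi (0 : ℝ), (corrWeight β l : ℂ) * eulerKernel α (l / (1 + l)) z) /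
    (∫ l in Ioi (0 : ℝ), corrWeight β l : ℝ)

/-- The holomorphic extension of the normalized correlation function. -/
noncomputable def corrExt (α β : ℝ) (z : ℂ) : ℂ := z * corrAvg α β z

theorem map_div_ofReal (L : ℂ →L[ℝ] ℝ) (v : ℂ) (r : ℝ) : L (v / (r : ℂ)) = L v / r := by
  rw [div_eq_inv_mul, ← Complex.ofReal_inv, ← Complex.real_smul, map_smul, smul_eq_mul,
    div_eq_inv_mul]

/-- Real-linear functionals commute with the integral, so pointwise bounds on kernels pass to the
mean. The functionals used are `Re`, `Im (z ·)` and `Re + σ Im`. -/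
theorem integral_le_map_corrAvg (α : ℝ) {β : ℝ} (hβ : 0 < β) (hβ' : β ≤ 1 / 2) {z : ℂ}
    (hz : z ∈ doublySlitPlane) (L : ℂ →L[ℝ] ℝ) {c : ℝ → ℝ}
    (hc : IntegrableOn (fun l => corrWeight β l * c l) (Ioi 0))
    (h : ∀ l ∈ Ioi (0 : ℝ), c l ≤ L (eulerKernel α (l / (1 + l)) z)) :
    (∫ l in Ioi (0 : ℝ), corrWeight β l * c l) / (∫ l in Ioi (0 : ℝ), corrWeight β l) ≤
      L (corrAvg α β z) := by
  rw [corrAvg, map_div_ofReal]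
  exact div_le_div_of_nonneg_right (integral_mul_le_map_integral (fun l hl => (corrWeight_pos β hl).le)
    hc (integrableOn_mul_comp_div_one_add (integrableOn_corrWeight hβ hβ')
      (continuousOn_eulerKernel α hz)) L h) (integral_corrWeight_pos hβ hβ').le

theorem le_map_corrAvg (α : ℝ) {β : ℝ} (hβ : 0 < β) (hβ' : β ≤ 1 / 2) {z : ℂ}
    (hz : z ∈ doublySlitPlane) (L : ℂ →L[ℝ] ℝ) {c : ℝ}
    (h : ∀ t ∈ Icc (0 : ℝ) 1, c ≤ L (eulerKernel α t z)) : c ≤ L (corrAvg α β z) := by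
  have := integral_le_map_corrAvg α hβ hβ' hz L (c := fun _ => c)
    ((integrableOn_corrWeight hβ hβ').mul_const c)
    fun l hl => h _ (div_one_add_mem_Icc (Ioi_subset_Ici_self hl))
  rwa [integral_mul_const, mul_div_cancel_left₀ _ (integral_corrWeight_pos hβ hβ').ne'] at this

/-- The derivative of `corrExt`. -/
noncomputable def corrExtDeriv (α β : ℝ) (z : ℂ) : ℂ :=
  (∫ l in Ioi (0 : ℝ), (corrWeight β l : ℂ) * eulerKernelDeriv α (l / (1 + l)) z) /
    (∫ l in Ioi (0 : ℝ), corrWeight β l : ℝ)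

theorem continuousOn_eulerKernelDeriv_left (α : ℝ) {z : ℂ} (hz : z ∈ doublySlitPlane) :
    ContinuousOn (fun t : ℝ => eulerKernelDeriv α t z) (Icc 0 1) :=
  (continuousOn_eulerKernelDeriv α).comp (f := fun t : ℝ => (t, z)) (by fun_prop)
    fun _ ht => ⟨ht, hz⟩

theorem hasDerivAt_corrExt (α : ℝ) {β : ℝ} (hβ : 0 < β) (hβ' : β ≤ 1 / 2) {z : ℂ}
    (hz : z ∈ doublySlitPlane) : HasDerivAt (corrExt α β) (corrExtDeriv α β z) z := by
  have hw := integrableOn_corrWeight hβ hβ'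
  obtain ⟨r, hr, hball⟩ := Metric.nhds_basis_closedBall.mem_iff.mp
    (isOpen_doublySlitPlane.mem_nhds hz)
  obtain ⟨B, hB⟩ := (isCompact_Icc.prod (isCompact_closedBall z r)).exists_bound_of_continuousOn
    ((continuousOn_eulerKernelDeriv α).mono (prod_mono_right hball))
  have hcont : ∀ y ∈ doublySlitPlane, ContinuousOn (fun t : ℝ => y * eulerKernel α t y) (Icc 0 1) :=
    fun y hy => continuousOn_const.mul (continuousOn_eulerKernel α hy)
  have key := hasDerivAt_integral_of_dominated_loc_of_deriv_le
    (μ := volume.restrict (Ioi (0 : ℝ))) (x₀ := z) (s := Metric.ball z r)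
    (F := fun y l => (corrWeight β l : ℂ) * (y * eulerKernel α (l / (1 + l)) y))
    (F' := fun y l => (corrWeight β l : ℂ) * eulerKernelDeriv α (l / (1 + l)) y)
    (bound := fun l => corrWeight β l * B) (Metric.ball_mem_nhds z hr)
    (by
      filter_upwards [isOpen_doublySlitPlane.mem_nhds hz] with y hy
      exact (integrableOn_mul_comp_div_one_add hw (hcont y hy)).aestronglyMeasurable)
    (integrableOn_mul_comp_div_one_add hw (hcont z hz))
    (integrableOn_mul_comp_div_one_add hw
      (continuousOn_eulerKernelDeriv_left α hz)).aestronglyMeasurable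
    (by
      filter_upwards [ae_restrict_mem measurableSet_Ioi] with l hl y hy
      rw [norm_mul, Complex.norm_real, Real.norm_of_nonneg (corrWeight_pos β hl).le]
      exact mul_le_mul_of_nonneg_left (hB (l / (1 + l), y)
        ⟨div_one_add_mem_Icc (Ioi_subset_Ici_self hl), Metric.ball_subset_closedBall hy⟩)
        (corrWeight_pos β hl).le)
    (hw.mul_const B)
    (by
      filter_upwards [ae_restrict_mem measurableSet_Ioi] with l hl y hy
      exact (hasDerivAt_mul_eulerKernel α (hball (Metric.ball_subset_closedBall hy))
        (div_one_add_mem_Icc (Ioi_subset_Ici_self hl))).const_mul _)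
  refine (key.2.div_const ((∫ l in Ioi (0 : ℝ), corrWeight β l : ℝ) : ℂ)).congr_of_eventuallyEq
    (.of_forall fun y => ?_)
  simp only [corrExt, corrAvg]
  rw [← mul_div_assoc, ← integral_const_mul]
  congr 2 with l
  ring

/-! ### The derivative as an average of kernels -/

theorem hasDerivAt_eulerKernel_comp (α : ℝ) {z : ℂ} (hz : z ∈ doublySlitPlane) {l : ℝ}
    (hl : 0 < l) :
    HasDerivAt (fun l : ℝ => eulerKernel α (l / (1 + l)) z)
      (((1 / (1 + l) ^ 2 : ℝ) : ℂ) * (((-α : ℝ) : ℂ) *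
        (1 - ((l / (1 + l) : ℝ) : ℂ) * z ^ 2) ^ (((-α : ℝ) : ℂ) - 1) * (-z ^ 2))) l := by
  have ht := div_one_add_mem_Icc (Ioi_subset_Ici_self (show l ∈ Ioi (0 : ℝ) from hl))
  have h1 : HasDerivAt (fun τ : ℂ => 1 - τ * z ^ 2) (-z ^ 2) ((l / (1 + l) : ℝ) : ℂ) := by
    simpa using ((hasDerivAt_id ((l / (1 + l) : ℝ) : ℂ)).mul_const (z ^ 2)).const_sub 1
  have h2 := (h1.cpow_const (c := ((-α : ℝ) : ℂ)) (one_sub_mul_sq_mem_slitPlane hz ht)).comp_ofReal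
  have h3 : HasDerivAt (fun l : ℝ => l / (1 + l)) (1 / (1 + l) ^ 2) l := by
    have := (hasDerivAt_id l).div ((hasDerivAt_id l).const_add 1) (by simp; positivity)
    refine this.congr_deriv ?_
    simp
  have := h2.scomp l h3
  rw [Complex.real_smul] at this
  exact this

/-- For the kernel `K`, `d/dz (z K) = K + 2 t ∂K/∂t` and `t ∂/∂t = l (1+l) ∂/∂l`. Integrating by
parts against `2 l^β (1+l)^(-1/2)` removes the derivative and leaves nonnegative weights, plus a
boundary term at `t = 1`. -/
theorem integral_corrWeight_mul_eulerKernelDeriv (α : ℝ) {β m : ℝ} (hβ : 0 < β) (hβ' : β ≤ 1 / 2)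
    {z : ℂ} (hz : z ∈ doublySlitPlane)
    (hm : Filter.Tendsto (fun l : ℝ => l ^ β * (1 + l) ^ (-(1 / 2) : ℝ)) Filter.atTop (nhds m))
    (hi : IntegrableOn (fun l : ℝ => (1 - 2 * β) * (l ^ (β - 1) * (1 + l) ^ (-(1 / 2) : ℝ))) (Ioi 0)) :
    ∫ l in Ioi (0 : ℝ), (corrWeight β l : ℂ) * eulerKernelDeriv α (l / (1 + l)) z =
      (∫ l in Ioi (0 : ℝ), (((1 - 2 * β) * (l ^ (β - 1) * (1 + l) ^ (-(1 / 2) : ℝ)) : ℝ) : ℂ) *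
        eulerKernel α (l / (1 + l)) z) + 2 * m * eulerKernel α 1 z := by
  have hw := integrableOn_corrWeight hβ hβ'
  have i1 := integrableOn_mul_comp_div_one_add hw (continuousOn_eulerKernelDeriv_left α hz)
  have i2 := integrableOn_mul_comp_div_one_add hi (continuousOn_eulerKernel α hz)
  have hcont : ContinuousOn (fun l : ℝ => ((2 * (l ^ β * (1 + l) ^ (-(1 / 2) : ℝ)) : ℝ) : ℂ) *
      eulerKernel α (l / (1 + l)) z) (Ici 0) := by
    refine ContinuousOn.mul ?_ (continuousOn_comp_div_one_add (continuousOn_eulerKernel α hz))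
    refine Complex.continuous_ofReal.comp_continuousOn (continuousOn_const.mul
      ((continuousOn_id.rpow_const fun l hl => .inr hβ.le).mul
      (ContinuousOn.rpow_const (by fun_prop) fun l hl => .inl ?_)))
    have : (0 : ℝ) ≤ l := hl
    positivity
  have htend : Filter.Tendsto (fun l : ℝ => ((2 * (l ^ β * (1 + l) ^ (-(1 / 2) : ℝ)) : ℝ) : ℂ) *
      eulerKernel α (l / (1 + l)) z) Filter.atTop (nhds (((2 * m : ℝ) : ℂ) * eulerKernel α 1 z)) := by
    refine Filter.Tendsto.mul ((Complex.continuous_ofReal.tendsto _).comp (hm.const_mul 2)) ?_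
    have h1 : Filter.Tendsto (fun l : ℝ => l / (1 + l)) Filter.atTop (nhds 1) := by
      have : Filter.Tendsto (fun l : ℝ => 1 - (1 + l)⁻¹) Filter.atTop (nhds (1 - 0)) :=
        tendsto_const_nhds.sub (tendsto_inv_atTop_zero.comp
          (Filter.tendsto_atTop_add_const_left _ 1 Filter.tendsto_id))
      rw [sub_zero] at this
      refine this.congr' ?_
      filter_upwards [Filter.eventually_ge_atTop 0] with l hl
      field_simp
      ring
    refine Filter.Tendsto.comp (continuousOn_eulerKernel α hz 1 (by simp)) ?_
    refine tendsto_nhdsWithin_iff.mpr ⟨h1, ?_⟩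
    filter_upwards [Filter.eventually_ge_atTop 0] with l hl using div_one_add_mem_Icc hl
  have key := integral_Ioi_of_hasDerivAt_of_tendsto (a := 0)
    (f' := fun l : ℝ => (corrWeight β l : ℂ) * eulerKernelDeriv α (l / (1 + l)) z -
      (((1 - 2 * β) * (l ^ (β - 1) * (1 + l) ^ (-(1 / 2) : ℝ)) : ℝ) : ℂ) *
        eulerKernel α (l / (1 + l)) z) (hcont 0 (by simp)) (fun l hl => ?_) (i1.sub i2) htend
  · rw [integral_sub i1 i2] at key
    have h0 : (0 : ℝ) ^ β = 0 := Real.zero_rpow hβ.ne'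
    rw [h0] at key
    push_cast at key ⊢
    linear_combination key
  · have hl0 : (0 : ℝ) < l := hl
    have hl1 : (0 : ℝ) < 1 + l := by linarith
    have h1 : HasDerivAt (fun l : ℝ => 2 * (l ^ β * (1 + l) ^ (-(1 / 2) : ℝ)))
        (2 * (β * l ^ (β - 1) * (1 + l) ^ (-(1 / 2) : ℝ) +
          l ^ β * (-(1 / 2) * (1 + l) ^ (-(3 / 2) : ℝ)))) l := by
      have ha := Real.hasDerivAt_rpow_const (x := l) (p := β) (.inl hl0.ne')
      have hb := ((hasDerivAt_id l).const_add 1).rpow_const (p := -(1 / 2)) (.inl hl1.ne')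
      refine ((ha.mul hb).const_mul 2).congr_deriv ?_
      norm_num
    refine (h1.ofReal_comp.mul (hasDerivAt_eulerKernel_comp α hz hl0)).congr_deriv ?_
    have e1 : l ^ β = l * l ^ (β - 1) := by
      rw [← Real.rpow_one_add' hl0.le (by simpa using hβ.ne')]; congr 1; ring
    have e2 : (1 + l) ^ (-(1 / 2) : ℝ) = (1 + l) * (1 + l) ^ (-(3 / 2) : ℝ) := by
      rw [← Real.rpow_one_add' hl1.le (by norm_num)]; congr 1; norm_num
    have hl1' : (1 + l : ℂ) ≠ 0 := by exact_mod_cast hl1.ne'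
    simp only [eulerKernelDeriv, corrWeight]
    rw [e2, e1]
    push_cast
    field_simp
    ring

theorem le_map_corrExtDeriv_of_tendsto (α : ℝ) {β m : ℝ} (hβ : 0 < β) (hβ' : β ≤ 1 / 2) {z : ℂ}
    (hz : z ∈ doublySlitPlane) (hm0 : 0 ≤ m)
    (hm : Filter.Tendsto (fun l : ℝ => l ^ β * (1 + l) ^ (-(1 / 2) : ℝ)) Filter.atTop (nhds m))
    (hi : IntegrableOn (fun l : ℝ => (1 - 2 * β) * (l ^ (β - 1) * (1 + l) ^ (-(1 / 2) : ℝ))) (Ioi 0))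
    (L : ℂ →L[ℝ] ℝ) {c : ℝ} (h : ∀ t ∈ Icc (0 : ℝ) 1, c ≤ L (eulerKernel α t z)) :
    c ≤ L (corrExtDeriv α β z) := by
  have hK := integral_corrWeight_pos hβ hβ'
  -- At `z = 0` the kernel is `1`, so the identity says that the new weights have the same total
  -- mass as the old one: `corrExtDeriv` is a true mean.
  have h0 := integral_corrWeight_mul_eulerKernelDeriv α hβ hβ' zero_mem_doublySlitPlane hm hi
  simp only [eulerKernelDeriv, eulerKernel_zero, zero_mul, add_zero, mul_one] at h0
  rw [integral_complex_ofReal, integral_complex_ofReal] at h0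
  norm_cast at h0
  rw [corrExtDeriv, map_div_ofReal, le_div_iff₀ hK,
    integral_corrWeight_mul_eulerKernelDeriv α hβ hβ' hz hm hi, map_add,
    show (2 * m * eulerKernel α 1 z : ℂ) = (2 * m : ℝ) • eulerKernel α 1 z by simp, map_smul,
    smul_eq_mul]
  have h1 := integral_mul_le_map_integral (c := fun _ => c) (fun l hl => ?_) (hi.mul_const c)
    (integrableOn_mul_comp_div_one_add hi (continuousOn_eulerKernel α hz)) L
    (fun l hl => h _ (div_one_add_mem_Icc (Ioi_subset_Ici_self hl)))
  · rw [integral_mul_const] at h1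
    have h2 := mul_le_mul_of_nonneg_left (h 1 (by simp)) (mul_nonneg zero_le_two hm0)
    rw [h0]
    linarith
  · have hl0 : (0 : ℝ) < l := hl
    exact mul_nonneg (by linarith) (by positivity)

theorem le_map_corrExtDeriv (α : ℝ) {β : ℝ} (hβ : 0 < β) (hβ' : β ≤ 1 / 2) {z : ℂ}
    (hz : z ∈ doublySlitPlane) (L : ℂ →L[ℝ] ℝ) {c : ℝ}
    (h : ∀ t ∈ Icc (0 : ℝ) 1, c ≤ L (eulerKernel α t z)) : c ≤ L (corrExtDeriv α β z) := by
  rcases lt_or_eq_of_le hβ' with hlt | rfl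
  · refine le_map_corrExtDeriv_of_tendsto α hβ hβ' hz le_rfl ?_
      ((integrableOn_rpow_mul_one_add_rpow (by linarith) (by norm_num) (by linarith)).const_mul _) L h
    refine squeeze_zero' ?_ ?_ (tendsto_rpow_neg_atTop (show 0 < 1 / 2 - β by linarith))
    · filter_upwards [Filter.eventually_ge_atTop 0] with l hl
      positivity
    · filter_upwards [Filter.eventually_gt_atTop 0] with l hl
      calc _ ≤ l ^ β * l ^ (-(1 / 2) : ℝ) := mul_le_mul_of_nonneg_left
            (Real.rpow_le_rpow_of_nonpos hl (by linarith) (by norm_num)) (by positivity)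
        _ = _ := by rw [← Real.rpow_add hl]; congr 1; ring
  -- At `β = 1/2` the factor `1 - 2β` kills the integral and the boundary term, with `m = 1`,
  -- carries all the mass; for `β < 1/2` it is the boundary term that vanishes.
  · refine le_map_corrExtDeriv_of_tendsto α hβ le_rfl hz zero_le_one ?_ (by simp) L h
    have h1 : Filter.Tendsto (fun l : ℝ => (1 - (1 + l)⁻¹) ^ (1 / 2 : ℝ)) Filter.atTop
        (nhds ((1 - 0) ^ (1 / 2 : ℝ))) :=
      (tendsto_const_nhds.sub (tendsto_inv_atTop_zero.comp
        (Filter.tendsto_atTop_add_const_left _ 1 Filter.tendsto_id))).rpow_const (.inr (by norm_num))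
    rw [sub_zero, Real.one_rpow] at h1
    refine h1.congr' ?_
    filter_upwards [Filter.eventually_ge_atTop 0] with l hl
    rw [show 1 - (1 + l)⁻¹ = l * (1 + l)⁻¹ by field_simp; ring, Real.mul_rpow hl (by positivity),
      Real.inv_rpow (by positivity), Real.rpow_neg (by positivity)]

/-- The mean of `t` is found by integrating the derivative of `l^β (1+l)^(-3/2)`, whose boundary
values are zero. -/
theorem integral_corrWeight_mul_div {β : ℝ} (hβ : 0 < β) (hβ' : β ≤ 1 / 2) :
    IntegrableOn (fun l => corrWeight β l * (l / (1 + l))) (Ioi 0) ∧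
    ∫ l in Ioi (0 : ℝ), corrWeight β l * (l / (1 + l)) =
      2 * β / 3 * ∫ l in Ioi (0 : ℝ), corrWeight β l := by
  have hw := integrableOn_corrWeight hβ hβ'
  have hi : IntegrableOn (fun l => corrWeight β l * (l / (1 + l))) (Ioi 0) := by
    refine (integrableOn_rpow_mul_one_add_rpow (p := β) (r := -(5 / 2)) (by linarith) (by norm_num)
      (by linarith)).congr_fun (fun l hl => ?_) measurableSet_Ioi
    have hl0 : (0 : ℝ) < l := hl
    have hl1 : (0 : ℝ) < 1 + l := by linarith
    have e1 : l ^ β = l * l ^ (β - 1) := by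
      rw [← Real.rpow_one_add' hl0.le (by simpa using hβ.ne')]; congr 1; ring
    have e2 : (1 + l) ^ (-(5 / 2) : ℝ) = (1 + l)⁻¹ * (1 + l) ^ (-(3 / 2) : ℝ) := by
      rw [← Real.rpow_neg_one, ← Real.rpow_add hl1]; norm_num
    simp only [corrWeight, e1, e2]
    field_simp
  refine ⟨hi, ?_⟩
  have hcont : ContinuousOn (fun l : ℝ => l ^ β * (1 + l) ^ (-(3 / 2) : ℝ)) (Ici 0) := by
    refine (continuousOn_id.rpow_const fun l hl => .inr hβ.le).mul
      (ContinuousOn.rpow_const (by fun_prop) fun l hl => .inl ?_)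
    have : (0 : ℝ) ≤ l := hl
    positivity
  have htend : Filter.Tendsto (fun l : ℝ => l ^ β * (1 + l) ^ (-(3 / 2) : ℝ)) Filter.atTop
      (nhds 0) := by
    refine squeeze_zero' ?_ ?_ (tendsto_rpow_neg_atTop (show 0 < 3 / 2 - β by linarith))
    · filter_upwards [Filter.eventually_ge_atTop 0] with l hl
      positivity
    · filter_upwards [Filter.eventually_gt_atTop 0] with l hl
      calc _ ≤ l ^ β * l ^ (-(3 / 2) : ℝ) := mul_le_mul_of_nonneg_left
            (Real.rpow_le_rpow_of_nonpos hl (by linarith) (by norm_num)) (by positivity)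
        _ = _ := by rw [← Real.rpow_add hl]; congr 1; ring
  have key := integral_Ioi_of_hasDerivAt_of_tendsto (a := 0)
    (f' := fun l : ℝ => β * corrWeight β l - 3 / 2 * (corrWeight β l * (l / (1 + l))))
    (hcont 0 (by simp)) (fun l hl => ?_) ((hw.const_mul β).sub (hi.const_mul (3 / 2))) htend
  · rw [integral_sub (hw.const_mul β) (hi.const_mul (3 / 2)), integral_const_mul,
      integral_const_mul, Real.zero_rpow hβ.ne'] at key
    linarith
  · have hl0 : (0 : ℝ) < l := hl
    have hl1 : (0 : ℝ) < 1 + l := by linarith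
    have ha := Real.hasDerivAt_rpow_const (x := l) (p := β) (.inl hl0.ne')
    have hb := ((hasDerivAt_id l).const_add 1).rpow_const (p := -(3 / 2)) (.inl hl1.ne')
    refine (ha.mul hb).congr_deriv ?_
    have e1 : l ^ β = l * l ^ (β - 1) := by
      rw [← Real.rpow_one_add' hl0.le (by simpa using hβ.ne')]; congr 1; ring
    have e2 : (1 + l) ^ (-(3 / 2) - 1 : ℝ) = (1 + l)⁻¹ * (1 + l) ^ (-(3 / 2) : ℝ) := by
      rw [← Real.rpow_neg_one, ← Real.rpow_add hl1]; norm_num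
    simp only [corrWeight, id, e1, e2]
    field_simp
    ring

/-! ### Positivity, symmetry and real values of the extension -/

theorem exists_pos_le_re_eulerKernel {α : ℝ} {z : ℂ} (hα0 : 0 < α) (hα : α ≤ 1 / 2)
    (hz : z ∈ doublySlitPlane) : ∃ c > 0, ∀ t ∈ Icc (0 : ℝ) 1, c ≤ (eulerKernel α t z).re := by
  obtain ⟨t, ht, hmin⟩ := isCompact_Icc.exists_isMinOn (nonempty_Icc.mpr zero_le_one)
    (Complex.continuous_re.comp_continuousOn (continuousOn_eulerKernel α hz))
  exact ⟨_, re_eulerKernel_pos hα0 hα hz ht, fun s hs => hmin hs⟩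

theorem re_corrExtDeriv_pos {α β : ℝ} {z : ℂ} (hα0 : 0 < α) (hα : α ≤ 1 / 2) (hβ : 0 < β)
    (hβ' : β ≤ 1 / 2) (hz : z ∈ doublySlitPlane) : 0 < (corrExtDeriv α β z).re := by
  obtain ⟨c, hc, h⟩ := exists_pos_le_re_eulerKernel hα0 hα hz
  exact hc.trans_le (le_map_corrExtDeriv α hβ hβ' hz Complex.reCLM h)

/-- In `Im(z K) = x Im K + y Re K` the first term is nonnegative because `x y Im K ≥ 0` and `y > 0`.
-/
theorem im_corrExt_pos {α β : ℝ} {z : ℂ} (hα0 : 0 < α) (hα : α ≤ 1 / 2) (hβ : 0 < β)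
    (hβ' : β ≤ 1 / 2) (hz : 0 < z.im) : 0 < (corrExt α β z).im := by
  have hzD : z ∈ doublySlitPlane := .inl hz.ne'
  obtain ⟨c, hc, h⟩ := exists_pos_le_re_eulerKernel hα0 hα hzD
  have := le_map_corrAvg α hβ hβ' hzD (z.re • Complex.imCLM + z.im • Complex.reCLM)
    (c := z.im * c) fun t ht => by
      have h1 := re_mul_im_mul_im_eulerKernel_nonneg (z := z) hα0 hα ht
      have h2 : 0 ≤ z.re * (eulerKernel α t z).im := by
        by_contra! h3
        nlinarith
      have h4 := mul_le_mul_of_nonneg_left (h t ht) hz.le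
      simp
      linarith
  have hp := mul_pos hz hc
  simp at this
  rw [corrExt, Complex.mul_im]
  linarith

theorem corrExt_neg (α β : ℝ) (z : ℂ) : corrExt α β (-z) = -corrExt α β z := by
  simp [corrExt, corrAvg, eulerKernel_neg]

theorem corrExt_conj (α β : ℝ) {z : ℂ} (hz : z ∈ doublySlitPlane) :
    corrExt α β ((starRingEnd ℂ) z) = (starRingEnd ℂ) (corrExt α β z) := by
  rw [corrExt, corrExt, map_mul, corrAvg, corrAvg, map_div₀, Complex.conj_ofReal, ← integral_conj]
  congr 2
  refine setIntegral_congr_fun measurableSet_Ioi fun l hl => ?_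
  simp only [map_mul, Complex.conj_ofReal]
  rw [eulerKernel_conj α hz (div_one_add_mem_Icc (Ioi_subset_Ici_self hl))]

theorem corrExt_ofReal (α β : ℝ) {x : ℝ} (hx : |x| ≤ 1) :
    corrExt α β x = ((x * (∫ l in Ioi (0 : ℝ), corrWeight β l * (1 - x ^ 2 * (l / (1 + l))) ^ (-α)) /
      ∫ l in Ioi (0 : ℝ), corrWeight β l : ℝ) : ℂ) := by
  have : ∫ l in Ioi (0 : ℝ), (corrWeight β l : ℂ) * eulerKernel α (l / (1 + l)) x =
      ((∫ l in Ioi (0 : ℝ), corrWeight β l * (1 - x ^ 2 * (l / (1 + l))) ^ (-α) : ℝ) : ℂ) := by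
    rw [← integral_complex_ofReal]
    refine setIntegral_congr_fun measurableSet_Ioi fun l hl => ?_
    rw [eulerKernel_ofReal α hx (div_one_add_mem_Icc (Ioi_subset_Ici_self hl)), Complex.ofReal_mul]
  rw [corrExt, corrAvg, this]
  push_cast
  ring

/-! ### Quantitative lower bounds -/

theorem exists_sign_mul_im_eulerKernel_nonneg {α : ℝ} {z : ℂ} (hα0 : 0 < α) (hα : α ≤ 1 / 2)
    (hz : z ∈ doublySlitPlane) : ∃ σ : ℝ, |σ| = 1 ∧
      ∀ t ∈ Icc (0 : ℝ) 1, 0 ≤ σ * (eulerKernel α t z).im := by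
  rcases lt_trichotomy (z.re * z.im) 0 with h | h | h
  · refine ⟨-1, by simp, fun t ht => ?_⟩
    have := re_mul_im_mul_im_eulerKernel_nonneg (z := z) hα0 hα ht
    nlinarith
  · refine ⟨1, by simp, fun t ht => ?_⟩
    have him : (1 - (t : ℂ) * z ^ 2).im = -(2 * t * (z.re * z.im)) := by
      simp [pow_two]; ring
    rw [h, mul_zero, neg_zero] at him
    have hs := Complex.mem_slitPlane_iff.mp (one_sub_mul_sq_mem_slitPlane hz ht)
    have harg : (1 - (t : ℂ) * z ^ 2).arg = 0 :=
      Complex.arg_eq_zero_iff.mpr ⟨(hs.resolve_right (by simp [him])).le, him⟩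
    rw [eulerKernel, Complex.cpow_ofReal_im, harg]
    simp
  · refine ⟨1, by simp, fun t ht => ?_⟩
    have := re_mul_im_mul_im_eulerKernel_nonneg (z := z) hα0 hα ht
    nlinarith

/-- The real-linear functional `v ↦ Re v + σ Im v`. -/
noncomputable def reAddMulIm (σ : ℝ) : ℂ →L[ℝ] ℝ := Complex.reCLM + σ • Complex.imCLM

theorem reAddMulIm_le {σ : ℝ} (hσ : |σ| = 1) (v : ℂ) : reAddMulIm σ v ≤ √2 * ‖v‖ := by
  have hσ2 : σ ^ 2 = 1 := by rw [← sq_abs, hσ, one_pow]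
  refine le_trans (Real.le_sqrt_of_sq_le (y := 2 * ‖v‖ ^ 2) ?_) ?_
  · rw [Complex.sq_norm, Complex.normSq_apply]
    simp [reAddMulIm]
    nlinarith [sq_nonneg (v.re - σ * v.im)]
  · rw [Real.sqrt_mul zero_le_two, Real.sqrt_sq (norm_nonneg v)]

/-- All kernels lie in one closed quadrant, where `Re + σ Im` is `|Re| + |Im|` and dominates the
norm. Averaging this functional bounds the modulus of a mean from below, at the cost of the `√2` in
`reAddMulIm_le`. -/
theorem rpow_neg_half_le_reAddMulIm {α σ t : ℝ} {z : ℂ} (hα0 : 0 < α) (hα : α ≤ 1 / 2)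
    (hz : z ∈ doublySlitPlane) (ht : t ∈ Icc (0 : ℝ) 1) (hσ : |σ| = 1)
    (h : 0 ≤ σ * (eulerKernel α t z).im) :
    (1 + t * ‖z‖ ^ 2) ^ (-(1 / 2) : ℝ) ≤ reAddMulIm σ (eulerKernel α t z) := by
  have h1 : ‖eulerKernel α t z‖ ≤ reAddMulIm σ (eulerKernel α t z) := by
    refine (Complex.norm_le_abs_re_add_abs_im _).trans (le_of_eq ?_)
    rw [abs_of_pos (re_eulerKernel_pos hα0 hα hz ht)]
    have : |(eulerKernel α t z).im| = σ * (eulerKernel α t z).im := by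
      rw [← abs_of_nonneg h, abs_mul, hσ, one_mul]
    rw [this]
    simp [reAddMulIm]
  have hpos : 0 < ‖1 - (t : ℂ) * z ^ 2‖ :=
    norm_pos_iff.mpr (Complex.slitPlane_ne_zero (one_sub_mul_sq_mem_slitPlane hz ht))
  have h2 : ‖1 - (t : ℂ) * z ^ 2‖ ≤ 1 + t * ‖z‖ ^ 2 := by
    refine (norm_sub_le _ _).trans (le_of_eq ?_)
    rw [norm_one, norm_mul, norm_pow, Complex.norm_real, Real.norm_of_nonneg ht.1]
  refine le_trans ?_ h1
  rw [norm_eulerKernel]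
  calc (1 + t * ‖z‖ ^ 2) ^ (-(1 / 2) : ℝ) ≤ (1 + t * ‖z‖ ^ 2) ^ (-α) :=
        Real.rpow_le_rpow_of_exponent_le (by nlinarith [mul_nonneg ht.1 (sq_nonneg ‖z‖)])
          (by linarith)
    _ ≤ _ := Real.rpow_le_rpow_of_nonpos hpos h2 (by linarith)

theorem rpow_neg_half_eq_inv_sqrt {x : ℝ} (hx : 0 ≤ x) : x ^ (-(1 / 2) : ℝ) = (√x)⁻¹ := by
  rw [Real.rpow_neg hx, ← Real.sqrt_eq_rpow]

theorem norm_corrExtDeriv_ge {α β : ℝ} {z : ℂ} (hα0 : 0 < α) (hα : α ≤ 1 / 2) (hβ : 0 < β)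
    (hβ' : β ≤ 1 / 2) (hz : z ∈ doublySlitPlane) (hz3 : ‖z‖ ≤ 3) :
    2 / 9 ≤ ‖corrExtDeriv α β z‖ := by
  obtain ⟨σ, hσ, hs⟩ := exists_sign_mul_im_eulerKernel_nonneg hα0 hα hz
  have h := le_map_corrExtDeriv α hβ hβ' hz (reAddMulIm σ) (c := (√10)⁻¹) fun t ht => by
    refine le_trans ?_ (rpow_neg_half_le_reAddMulIm hα0 hα hz ht hσ (hs t ht))
    rw [← rpow_neg_half_eq_inv_sqrt (by norm_num)]
    have h9 : ‖z‖ ^ 2 ≤ 9 := by nlinarith [norm_nonneg z]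
    refine Real.rpow_le_rpow_of_nonpos ?_ ?_ (by norm_num)
    · nlinarith [mul_nonneg ht.1 (sq_nonneg ‖z‖)]
    · nlinarith [ht.1, ht.2, sq_nonneg ‖z‖]
  have h1 := h.trans (reAddMulIm_le hσ _)
  have h2 : 1 ≤ √20 * ‖corrExtDeriv α β z‖ := by
    rw [show (20 : ℝ) = 10 * 2 by norm_num, Real.sqrt_mul (by norm_num), mul_assoc]
    rwa [inv_le_iff_one_le_mul₀' (by positivity)] at h1
  -- `√20` is `√(1 + 3²)` from the kernel bound times the loss `√2`.
  have h3 : √20 ≤ 9 / 2 := Real.sqrt_le_iff.mpr (by norm_num)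
  nlinarith [norm_nonneg (corrExtDeriv α β z)]

theorem norm_corrExt_gt {α β : ℝ} {z : ℂ} (hα0 : 0 < α) (hα : α ≤ 1 / 2) (hβ : 0 < β)
    (hβ' : β ≤ 1 / 2) (hz : z ∈ doublySlitPlane) (hz3 : ‖z‖ = 3) :
    1.06 < ‖corrExt α β z‖ := by
  obtain ⟨σ, hσ, hs⟩ := exists_sign_mul_im_eulerKernel_nonneg hα0 hα hz
  obtain ⟨hi, hint⟩ := integral_corrWeight_mul_div hβ hβ'
  have hw := integrableOn_corrWeight hβ hβ'
  have hK := integral_corrWeight_pos hβ hβ'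
  have e : (fun l => corrWeight β l * (11 / 16 - 9 / 16 * (l / (1 + l)))) =
      fun l => corrWeight β l * (11 / 16) - 9 / 16 * (corrWeight β l * (l / (1 + l))) := by
    ext l; ring
  have h := integral_le_map_corrAvg α hβ hβ' hz (reAddMulIm σ)
    -- Tangent line at `t = 1/3` of the convex function `(1 + 9t)^(-1/2)`. As the mean of `t` is
    -- `2β/3 ≤ 1/3`, the average is at least `1/2`, whence `|F| ≥ 3/(2√2) > 1.06`.
    (c := fun l => 11 / 16 - 9 / 16 * (l / (1 + l)))
    (by rw [e]; exact (hw.mul_const _).sub (hi.const_mul _)) fun l hl => by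
    have ht := div_one_add_mem_Icc (Ioi_subset_Ici_self hl)
    refine le_trans ?_ (rpow_neg_half_le_reAddMulIm hα0 hα hz ht hσ (hs _ ht))
    rw [hz3]
    generalize l / (1 + l) = t at ht
    have h0 : 0 ≤ 1 + t * 3 ^ 2 := by nlinarith [ht.1]
    rw [rpow_neg_half_eq_inv_sqrt h0]
    have hs1 : 1 ≤ √(1 + t * 3 ^ 2) := Real.one_le_sqrt.mpr (by nlinarith [ht.1])
    have hs2 := Real.sq_sqrt h0
    set s := √(1 + t * 3 ^ 2)
    rw [show 11 / 16 - 9 / 16 * t = 3 / 4 - s ^ 2 / 16 by rw [hs2]; ring,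
      ← one_div, le_div_iff₀ (by linarith)]
    nlinarith [mul_nonneg (sq_nonneg (s - 2)) (show 0 ≤ s + 4 by linarith)]
  rw [e, integral_sub (hw.mul_const _) (hi.const_mul _), integral_mul_const, integral_const_mul,
    hint] at h
  have h1 : 1 / 2 ≤ √2 * ‖corrAvg α β z‖ := by
    refine le_trans ?_ (h.trans (reAddMulIm_le hσ _))
    rw [le_div_iff₀ hK]
    nlinarith
  have h2 : √2 < 1.415 := (Real.sqrt_lt' (by norm_num)).mpr (by norm_num)
  rw [corrExt, norm_mul, hz3]
  by_contra! h3
  nlinarith [norm_nonneg (corrAvg α β z), Real.sqrt_nonneg 2]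

/-- Bernoulli's inequality gives `(1 - u)^(-α) ≥ 1 + α u`, then the mean of `t` is inserted. As `x →
1` the bound tends to a number above `1`: the source of the gain `ε`. -/
theorem le_re_corrExt_ofReal {α β x : ℝ} (hα0 : 0 < α) (hα : α ≤ 1 / 2) (hβ : 0 < β)
    (hβ' : β ≤ 1 / 2) (hx0 : 0 < x) (hx1 : x < 1) :
    x * (1 + α * x ^ 2 * (2 * β / 3)) ≤ (corrExt α β x).re := by
  obtain ⟨hi, hint⟩ := integral_corrWeight_mul_div hβ hβ'
  have hw := integrableOn_corrWeight hβ hβ'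
  have hK := integral_corrWeight_pos hβ hβ'
  have hxD : (x : ℂ) ∈ doublySlitPlane := .inr (by simpa [abs_of_pos hx0] using hx1)
  have e : (fun l => corrWeight β l * (1 + α * x ^ 2 * (l / (1 + l)))) =
      fun l => corrWeight β l + α * x ^ 2 * (corrWeight β l * (l / (1 + l))) := by
    ext l; ring
  have h := integral_le_map_corrAvg α hβ hβ' hxD Complex.reCLM
    (c := fun l => 1 + α * x ^ 2 * (l / (1 + l)))
    (by rw [e]; exact hw.add (hi.const_mul _)) fun l hl => by
    have ht := div_one_add_mem_Icc (Ioi_subset_Ici_self hl)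
    rw [eulerKernel_ofReal α (by rw [abs_of_pos hx0]; exact hx1.le) ht, Complex.reCLM_apply,
      Complex.ofReal_re]
    generalize l / (1 + l) = t at ht
    have h1 : x ^ 2 * t < 1 := by nlinarith [ht.1, ht.2]
    have h2 : 0 ≤ x ^ 2 * t := mul_nonneg (sq_nonneg x) ht.1
    have h3 : (1 + -(x ^ 2 * t)) ^ α ≤ 1 + α * -(x ^ 2 * t) :=
      rpow_one_add_le_one_add_mul_self (by linarith) hα0.le (by linarith)
    have h4 : 0 < (1 + -(x ^ 2 * t)) ^ α := Real.rpow_pos_of_pos (by linarith) _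
    rw [sub_eq_add_neg, Real.rpow_neg (by linarith), ← one_div, le_div_iff₀ h4]
    nlinarith [mul_nonneg hα0.le h2]
  rw [e, integral_add hw (hi.const_mul _), integral_const_mul, hint] at h
  have h1 : 1 + α * x ^ 2 * (2 * β / 3) ≤ (corrAvg α β x).re := by
    refine le_trans (le_of_eq ?_) h
    field_simp
  rw [corrExt, Complex.re_ofReal_mul]
  exact mul_le_mul_of_nonneg_left h1 hx0.le

/-! ### Injectivity -/

/-- Along a segment in the doubly slit plane, `corrExt` moves in the direction of the segment. -/
theorem re_conj_mul_corrExt_lt {α β : ℝ} (hα0 : 0 < α) (hα : α ≤ 1 / 2) (hβ : 0 < β)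
    (hβ' : β ≤ 1 / 2) {z d : ℂ} (hd : d ≠ 0)
    (h : ∀ s ∈ Icc (0 : ℝ) 1, z + s * d ∈ doublySlitPlane) :
    ((starRingEnd ℂ) d * corrExt α β z).re < ((starRingEnd ℂ) d * corrExt α β (z + d)).re := by
  set φ : ℝ → ℝ := fun s => ((starRingEnd ℂ) d * corrExt α β (z + s * d)).re with hφ
  have hder : ∀ s ∈ Icc (0 : ℝ) 1,
      HasDerivAt φ (‖d‖ ^ 2 * (corrExtDeriv α β (z + s * d)).re) s := fun s hs => by
    have hline : HasDerivAt (fun s : ℝ => z + s * d) d s := by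
      simpa using ((Complex.ofRealCLM.hasDerivAt (x := s)).mul_const d).const_add z
    have h1 := ((hasDerivAt_corrExt α hβ hβ' (h s hs)).scomp s hline).const_mul ((starRingEnd ℂ) d)
    have h2 := Complex.reCLM.hasFDerivAt.comp_hasDerivAt s h1
    refine h2.congr_deriv ?_
    simp only [Complex.reCLM_apply, smul_eq_mul]
    rw [← mul_assoc, mul_comm ((starRingEnd ℂ) d), Complex.mul_conj, Complex.re_ofReal_mul,
      Complex.normSq_eq_norm_sq]
  obtain ⟨s, hs, hslope⟩ := exists_hasDerivAt_eq_slope φ _ zero_lt_one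
    (fun s hs => (hder s hs).continuousAt.continuousWithinAt)
    (fun s hs => hder s (Ioo_subset_Icc_self hs))
  have hpos : 0 < ‖d‖ ^ 2 * (corrExtDeriv α β (z + s * d)).re :=
    mul_pos (pow_pos (norm_pos_iff.mpr hd) 2)
      (re_corrExtDeriv_pos hα0 hα hβ hβ' (h s (Ioo_subset_Icc_self hs)))
  rw [hslope, sub_zero, div_one] at hpos
  simpa [hφ] using hpos

theorem im_corrExt_eq_zero (α β : ℝ) {z : ℂ} (hz : z ∈ doublySlitPlane) (h : z.im = 0) :
    (corrExt α β z).im = 0 := by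
  have h1 := corrExt_conj α β hz
  rw [Complex.conj_eq_iff_im.mpr h] at h1
  exact Complex.conj_eq_iff_im.mp h1.symm

theorem im_corrExt_neg {α β : ℝ} {z : ℂ} (hα0 : 0 < α) (hα : α ≤ 1 / 2) (hβ : 0 < β)
    (hβ' : β ≤ 1 / 2) (hz : z.im < 0) : (corrExt α β z).im < 0 := by
  have := im_corrExt_pos (z := -z) hα0 hα hβ hβ' (by simpa using hz)
  rw [corrExt_neg] at this
  simpa using this

/-- The cut plane is not convex, but its two open half planes and its real interval are, and on each
of them `Re F' > 0` suffices. Points from different pieces are separated by the sign of `Im F`. -/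
theorem injOn_corrExt {α β : ℝ} (hα0 : 0 < α) (hα : α ≤ 1 / 2) (hβ : 0 < β) (hβ' : β ≤ 1 / 2) :
    InjOn (corrExt α β) doublySlitPlane := by
  intro z hz w hw he
  by_contra hne
  have hd : w - z ≠ 0 := sub_ne_zero.mpr (Ne.symm hne)
  suffices h : ∀ s ∈ Icc (0 : ℝ) 1, z + s * (w - z) ∈ doublySlitPlane by
    have := re_conj_mul_corrExt_lt hα0 hα hβ hβ' hd h
    rw [add_sub_cancel, he] at this
    exact lt_irrefl _ this
  rintro s ⟨hs0, hs1⟩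
  have him : (z + s * (w - z)).im = (1 - s) * z.im + s * w.im := by simp; ring
  have hre : (z + s * (w - z)).re = (1 - s) * z.re + s * w.re := by simp; ring
  have hs1' : 0 ≤ 1 - s := by linarith
  have hconv : ∀ {x y : ℝ}, 0 < x → 0 < y → 0 < (1 - s) * x + s * y := fun {x y} hx hy => by
    rcases hs0.eq_or_lt with rfl | h0
    · simpa using hx
    · nlinarith [mul_pos h0 hy, mul_nonneg hs1' hx.le]
  rcases lt_trichotomy z.im 0 with h | h | h <;> rcases lt_trichotomy w.im 0 with h' | h' | h'
  · refine .inl ?_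
    rw [him]
    have := hconv (neg_pos.mpr h) (neg_pos.mpr h')
    intro h0
    linarith
  · linarith [im_corrExt_neg hα0 hα hβ hβ' h, im_corrExt_eq_zero α β hw h', congrArg Complex.im he]
  · linarith [im_corrExt_neg hα0 hα hβ hβ' h, im_corrExt_pos hα0 hα hβ hβ' h',
      congrArg Complex.im he]
  · linarith [im_corrExt_neg hα0 hα hβ hβ' h', im_corrExt_eq_zero α β hz h, congrArg Complex.im he]
  · refine .inr ?_
    have h1 := abs_lt.mp (hz.resolve_left (not_not.mpr h))
    have h2 := abs_lt.mp (hw.resolve_left (not_not.mpr h'))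
    rw [hre, abs_lt]
    have h3 := hconv (x := 1 - z.re) (y := 1 - w.re) (by linarith) (by linarith)
    have h4 := hconv (x := 1 + z.re) (y := 1 + w.re) (by linarith) (by linarith)
    constructor <;> linarith
  · linarith [im_corrExt_pos hα0 hα hβ hβ' h', im_corrExt_eq_zero α β hz h, congrArg Complex.im he]
  · linarith [im_corrExt_pos hα0 hα hβ hβ' h, im_corrExt_neg hα0 hα hβ hβ' h',
      congrArg Complex.im he]
  · linarith [im_corrExt_pos hα0 hα hβ hβ' h, im_corrExt_eq_zero α β hw h', congrArg Complex.im he]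
  · refine .inl ?_
    rw [him]
    exact (hconv h h').ne'

/-! ### The image contains a disc of radius above one; the inverse -/

theorem hasStrictDerivAt_corrExt (α : ℝ) {β : ℝ} (hβ : 0 < β) (hβ' : β ≤ 1 / 2) {z : ℂ}
    (hz : z ∈ doublySlitPlane) : HasStrictDerivAt (corrExt α β) (corrExtDeriv α β z) z := by
  have hd : DifferentiableOn ℂ (corrExt α β) doublySlitPlane := fun y hy =>
    (hasDerivAt_corrExt α hβ hβ' hy).differentiableAt.differentiableWithinAt
  have := (hd.analyticAt (isOpen_doublySlitPlane.mem_nhds hz)).hasStrictDerivAt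
  rwa [(hasDerivAt_corrExt α hβ hβ' hz).deriv] at this

theorem corrExtDeriv_ne_zero {α β : ℝ} {z : ℂ} (hα0 : 0 < α) (hα : α ≤ 1 / 2) (hβ : 0 < β)
    (hβ' : β ≤ 1 / 2) (hz : z ∈ doublySlitPlane) : corrExtDeriv α β z ≠ 0 := fun h => by
  have := re_corrExtDeriv_pos hα0 hα hβ hβ' hz
  rw [h] at this
  simp at this

/-- Near the slits the norm of `corrExt`
exceeds some `R > 1`. -/
theorem exists_norm_corrExt_gt_near_slits {α β : ℝ} (hα0 : 0 < α) (hα : α ≤ 1 / 2) (hβ : 0 < β)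
    (hβ' : β ≤ 1 / 2) : ∃ R x₀ η : ℝ, 1 < R ∧ R ≤ 1.06 ∧ 0 < x₀ ∧ x₀ < 1 ∧ 0 < η ∧
      ∀ z ∈ doublySlitPlane, |z.im| < η → x₀ < |z.re| → R < ‖corrExt α β z‖ := by
  set κ := α * (2 * β / 3) with hκ
  have hκ0 : 0 < κ := by positivity
  have hcont : Filter.Tendsto (fun x : ℝ => x * (1 + α * x ^ 2 * (2 * β / 3))) (nhdsWithin 1 (Iio 1))
      (nhds (1 + κ)) := by
    have : Continuous (fun x : ℝ => x * (1 + α * x ^ 2 * (2 * β / 3))) := by fun_prop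
    have h := this.tendsto 1
    simp only [one_pow, mul_one, one_mul] at h
    exact h.mono_left nhdsWithin_le_nhds
  have h0 : ∀ᶠ x : ℝ in nhdsWithin 1 (Iio 1), 0 < x :=
    nhdsWithin_le_nhds (lt_mem_nhds zero_lt_one)
  obtain ⟨x₀, hx, hx0, hx1⟩ := ((hcont.eventually (lt_mem_nhds
    (show 1 + κ / 2 < 1 + κ by linarith))).and (h0.and self_mem_nhdsWithin)).exists
  have hx1 : x₀ < 1 := hx1
  set R := min 1.06 (1 + κ / 2) with hR
  have hR1 : 1 < R := lt_min (by norm_num) (by linarith)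
  have hre : R < (corrExt α β x₀).re := lt_of_le_of_lt (min_le_right _ _)
    (hx.trans_le (le_re_corrExt_ofReal hα0 hα hβ hβ' hx0 hx1))
  have hxD : (x₀ : ℂ) ∈ doublySlitPlane := .inr (by simpa [abs_of_pos hx0] using hx1)
  have hc : ContinuousAt (fun z => (corrExt α β z).re) x₀ :=
    Complex.continuous_re.continuousAt.comp (hasDerivAt_corrExt α hβ hβ' hxD).continuousAt
  obtain ⟨η, hη, hball⟩ := Metric.eventually_nhds_iff.mp (hc.eventually (lt_mem_nhds hre))
  have hpos : ∀ z ∈ doublySlitPlane, |z.im| < η → x₀ < z.re → R < ‖corrExt α β z‖ := by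
    intro z hz him hzre
    set y : ℂ := ⟨x₀, z.im⟩ with hy
    have h1 : R < (corrExt α β y).re := by
      refine hball ?_
      have : y - x₀ = z.im * Complex.I := by
        apply Complex.ext <;> simp [hy]
      rw [dist_eq_norm, this]
      simpa using him
    have hd : ((z.re - x₀ : ℝ) : ℂ) ≠ 0 := by
      exact_mod_cast (sub_pos.mpr hzre).ne'
    -- `Re F` increases along the horizontal segment from `x₀ + i Im z` to `z`, so the bound valid
    -- near `x₀` by continuity persists all the way to the right.
    have h2 := re_conj_mul_corrExt_lt hα0 hα hβ hβ' (z := y) hd fun s hs => by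
      rcases hz with h | h
      · left
        simpa [hy] using h
      · right
        rw [abs_lt] at h ⊢
        have hm : (y + s * ((z.re - x₀ : ℝ) : ℂ)).re = x₀ + s * (z.re - x₀) := by simp [hy]
        rw [hm]
        constructor
        · nlinarith [hs.1, mul_nonneg hs.1 (sub_pos.mpr hzre).le]
        · nlinarith [hs.1, hs.2, sub_pos.mpr hzre]
    have hyz : y + ((z.re - x₀ : ℝ) : ℂ) = z := by apply Complex.ext <;> simp [hy]
    rw [hyz, Complex.conj_ofReal, Complex.re_ofReal_mul, Complex.re_ofReal_mul] at h2
    have h3 := lt_of_mul_lt_mul_left h2 (sub_pos.mpr hzre).le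
    exact (h1.trans h3).trans_le ((le_abs_self _).trans (Complex.abs_re_le_norm _))
  refine ⟨R, x₀, η, hR1, min_le_left _ _, hx0, hx1, hη, fun z hz him hzre => ?_⟩
  rcases lt_abs.mp hzre with h | h
  · exact hpos z hz him h
  · have := hpos (-z) (neg_mem_doublySlitPlane hz) (by simpa using him) (by simpa using h)
    rwa [corrExt_neg, norm_neg] at this

/-- Inside the disc the image of the open set `Ω` coincides with that of the compact set `K`, since
`|F| > R` near the slits and on `|z| = 3`. It is therefore open and closed in the disc, and it
contains `0`. -/
theorem exists_ball_subset_image_corrExt {α β : ℝ} (hα0 : 0 < α) (hα : α ≤ 1 / 2) (hβ : 0 < β)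
    (hβ' : β ≤ 1 / 2) : ∃ R : ℝ, 1 < R ∧ R ≤ 1.06 ∧
      Metric.ball (0 : ℂ) R ⊆ corrExt α β '' (doublySlitPlane ∩ Metric.ball 0 3) := by
  obtain ⟨R, x₀, η, hR1, hR2, hx0, hx1, hη, hslit⟩ :=
    exists_norm_corrExt_gt_near_slits hα0 hα hβ hβ'
  refine ⟨R, hR1, hR2, ?_⟩
  set Ω := doublySlitPlane ∩ Metric.ball (0 : ℂ) 3 with hΩ
  set K := Metric.closedBall (0 : ℂ) 3 ∩ {z | η ≤ |z.im| ∨ |z.re| ≤ x₀} with hKdef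
  have hK : IsCompact K := (isCompact_closedBall 0 3).inter_right
    ((isClosed_le continuous_const Complex.continuous_im.abs).union
      (isClosed_le Complex.continuous_re.abs continuous_const))
  have hKD : K ⊆ doublySlitPlane := by
    rintro z ⟨-, h | h⟩
    · exact .inl (abs_pos.mp (hη.trans_le h))
    · exact .inr (h.trans_lt hx1)
  have hopen : IsOpen (corrExt α β '' Ω) := by
    rw [isOpen_iff_mem_nhds]
    rintro _ ⟨z, hz, rfl⟩
    rw [← (hasStrictDerivAt_corrExt α hβ hβ' hz.1).map_nhds_eq
      (corrExtDeriv_ne_zero hα0 hα hβ hβ' hz.1)]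
    exact Filter.image_mem_map ((isOpen_doublySlitPlane.inter Metric.isOpen_ball).mem_nhds hz)
  have hclosed : IsClosed (corrExt α β '' K) := (hK.image_of_continuousOn fun z hz =>
    (hasDerivAt_corrExt α hβ hβ' (hKD hz)).continuousAt.continuousWithinAt).isClosed
  have hsub : Metric.ball 0 R ∩ corrExt α β '' Ω ⊆ corrExt α β '' K := by
    rintro _ ⟨hw, z, hz, rfl⟩
    refine ⟨z, ⟨Metric.ball_subset_closedBall hz.2, ?_⟩, rfl⟩
    by_contra! h
    rw [mem_ball_zero_iff] at hw
    simp only [mem_ofPred_eq, not_or, not_le] at h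
    exact lt_asymm hw (hslit z hz.1 h.1 h.2)
  have hsub' : Metric.ball 0 R ∩ corrExt α β '' K ⊆ corrExt α β '' Ω := by
    rintro _ ⟨hw, z, hz, rfl⟩
    refine ⟨z, ⟨hKD hz, ?_⟩, rfl⟩
    rw [mem_ball_zero_iff] at hw ⊢
    refine lt_of_le_of_ne (mem_closedBall_zero_iff.mp hz.1) fun h3 => ?_
    linarith [norm_corrExt_gt hα0 hα hβ hβ' (hKD hz) h3]
  have key := IsPreconnected.subset_left_of_subset_union
    (s := Metric.ball (0 : ℂ) R) (hopen.inter Metric.isOpen_ball) hclosed.isOpen_compl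
    (by
      rw [Set.disjoint_left]
      rintro w ⟨hw1, hw2⟩ hw3
      exact hw3 (hsub ⟨hw2, hw1⟩))
    (fun w hw => by
      by_cases h : w ∈ corrExt α β '' K
      · exact .inl ⟨hsub' ⟨hw, h⟩, hw⟩
      · exact .inr h)
    ⟨0, by simp; linarith, ⟨0, ⟨zero_mem_doublySlitPlane, by simp⟩, by simp [corrExt]⟩,
      by simp; linarith⟩
    (convex_ball _ _).isPreconnected
  exact key.trans inter_subset_left

/-- The inverse of `corrExt` on a disc of radius larger than one. -/
theorem exists_inverse_corrExt {α β : ℝ} (hα0 : 0 < α) (hα : α ≤ 1 / 2) (hβ : 0 < β)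
    (hβ' : β ≤ 1 / 2) : ∃ (R : ℝ) (G : ℂ → ℂ), 1 < R ∧ R ≤ 1.06 ∧
      (∀ w ∈ Metric.ball (0 : ℂ) R, G w ∈ doublySlitPlane ∧ corrExt α β (G w) = w) ∧
      ∀ w ∈ Metric.ball (0 : ℂ) R, ∃ g', HasDerivAt G g' w ∧ ‖g'‖ ≤ 9 / 2 := by
  obtain ⟨R, hR1, hR2, hsub⟩ := exists_ball_subset_image_corrExt hα0 hα hβ hβ'
  choose! G hG using fun w (hw : w ∈ Metric.ball (0 : ℂ) R) => hsub hw
  refine ⟨R, G, hR1, hR2, fun w hw => ⟨(hG w hw).1.1, (hG w hw).2⟩, fun w hw => ?_⟩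
  obtain ⟨⟨hzD, hz3⟩, hz⟩ := hG w hw
  have hs := hasStrictDerivAt_corrExt α hβ hβ' hzD
  have hne := corrExtDeriv_ne_zero hα0 hα hβ hβ' hzD
  have hinv := (hs.to_localInverse hne).hasDerivAt
  have hleft : HasStrictDerivAt.localInverse _ _ _ hs hne (corrExt α β (G w)) = G w :=
    HasStrictFDerivAt.localInverse_apply_image _
  have hright := HasStrictFDerivAt.eventually_right_inverse (hs.hasStrictFDerivAt_equiv hne)
  have hmem := hinv.continuousAt.eventually_mem (s := doublySlitPlane)
    (by rw [hleft]; exact isOpen_doublySlitPlane.mem_nhds hzD)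
  rw [hz] at hinv hright hmem
  refine ⟨_, hinv.congr_of_eventuallyEq ?_, ?_⟩
  -- `G` comes from choice; global injectivity identifies it near `w` with the holomorphic local
  -- inverse.
  · filter_upwards [hright, hmem, Metric.isOpen_ball.mem_nhds hw] with v hv1 hv2 hv3
    exact injOn_corrExt hα0 hα hβ hβ' (hG v hv3).1.1 hv2 ((hG v hv3).2.trans hv1.symm)
  · rw [norm_inv]
    have := norm_corrExtDeriv_ge hα0 hα hβ hβ' hzD (mem_ball_zero_iff.mp hz3).le
    rw [inv_le_comm₀ (by linarith) (by norm_num)]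
    linarith

/-! ### Return to the real line and Cauchy's estimate -/

theorem iteratedDeriv_ofReal_eq {h : ℝ → ℝ} {H : ℂ → ℂ} {U : Set ℂ} (hU : IsOpen U)
    (hH : DifferentiableOn ℂ H U) (he : ∀ y : ℝ, (y : ℂ) ∈ U → (h y : ℂ) = H y) (k : ℕ) :
    ∀ y : ℝ, (y : ℂ) ∈ U → ((iteratedDeriv k h y : ℝ) : ℂ) = iteratedDeriv k H y := by
  induction k generalizing h H with
  | zero => simpa using he
  | succ k ih =>
    simp_rw [iteratedDeriv_succ']
    refine ih (hH.deriv hU) fun y hy => ?_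
    have h1 := ((hH.differentiableAt (hU.mem_nhds hy)).hasDerivAt).comp_ofReal
    have hV : ∀ᶠ x : ℝ in nhds y, (x : ℂ) ∈ U :=
      Complex.continuous_ofReal.continuousAt.eventually_mem (hU.mem_nhds hy)
    have h2 : HasDerivAt (fun x : ℝ => (h x : ℂ)) (deriv H y) y :=
      h1.congr_of_eventuallyEq (hV.mono he)
    have h3 := Complex.reCLM.hasFDerivAt.comp_hasDerivAt y h2
    have h4 : HasDerivAt h (deriv H y).re y := h3
    rw [h4.deriv]
    have h5 := h4.ofReal_comp
    exact h5.unique h2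

/-- Argued on the real integral, because `±1` lie outside the cut plane: the kernel increases with
`ρ²`, and `f` is odd. -/
theorem strictMonoOn_normHolderCorr {a b α β : ℝ} (ha0 : 0 ≤ a) (hα0 : 0 < α)
    (hα : a = 1 - 2 * α) (hβ : 0 < β) (hβ' : β ≤ 1 / 2) (hb : b = 1 - 2 * β) :
    StrictMonoOn (normHolderCorr a b) (Icc (-1) 1) := by
  have hK := integral_corrWeight_pos hβ hβ'
  set I : ℝ → ℝ := fun s => ∫ l in Ioi (0 : ℝ), corrWeight β l * (1 - s * (l / (1 + l))) ^ (-α)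
    with hI
  have hf : ∀ ρ : ℝ, |ρ| ≤ 1 → normHolderCorr a b ρ =
      ρ * I (ρ ^ 2) / ∫ l in Ioi (0 : ℝ), corrWeight β l := fun ρ hρ =>
    normHolderCorr_eq ha0 (by linarith) hα hβ hβ' hb hρ
  have hbase : ∀ l ∈ Ioi (0 : ℝ), ∀ s ≤ 1, (1 + l)⁻¹ ≤ 1 - s * (l / (1 + l)) := fun l hl s hs => by
    have hl0 : (0 : ℝ) < l := hl
    have h1 : 1 - l / (1 + l) = (1 + l)⁻¹ := by field_simp; ring
    have h2 : 0 ≤ l / (1 + l) := by positivity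
    nlinarith
  have hle : ∀ l ∈ Ioi (0 : ℝ), ∀ s t, s ≤ t → t ≤ 1 →
      (1 - s * (l / (1 + l))) ^ (-α) ≤ (1 - t * (l / (1 + l))) ^ (-α) := fun l hl s t hst ht => by
    have hl0 : (0 : ℝ) < l := hl
    have h2 : 0 ≤ l / (1 + l) := by positivity
    have h3 : 0 < (1 + l)⁻¹ := by positivity
    exact Real.rpow_le_rpow_of_nonpos (h3.trans_le (hbase l hl t ht)) (by nlinarith) (by linarith)
  have hint : ∀ s ≤ 1, IntegrableOn (fun l => corrWeight β l * (1 - s * (l / (1 + l))) ^ (-α))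
      (Ioi 0) := fun s hs => by
    -- The worst case `s = 1` has kernel `(1+l)^α`, still integrable because `α + β < 3/2`.
    refine Integrable.mono' (integrableOn_rpow_mul_one_add_rpow (p := β - 1) (r := -(3 / 2) + α)
      (by linarith) (by linarith) (by linarith)) ?_ ?_
    · have : Measurable (fun l => corrWeight β l * (1 - s * (l / (1 + l))) ^ (-α)) := by
        unfold corrWeight; fun_prop
      exact this.aestronglyMeasurable
    · filter_upwards [ae_restrict_mem measurableSet_Ioi] with l hl
      have hl0 : (0 : ℝ) < l := hl
      have h3 : 0 < (1 + l)⁻¹ := by positivity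
      have h4 := h3.trans_le (hbase l hl s hs)
      rw [Real.norm_of_nonneg (mul_nonneg (corrWeight_pos β hl).le (Real.rpow_nonneg h4.le _)),
        Real.rpow_add (by positivity), ← mul_assoc]
      refine mul_le_mul_of_nonneg_left ?_ (corrWeight_pos β hl).le
      calc _ ≤ ((1 + l)⁻¹) ^ (-α) :=
            Real.rpow_le_rpow_of_nonpos h3 (hbase l hl s hs) (by linarith)
        _ = _ := by rw [Real.inv_rpow (by positivity), Real.rpow_neg (by positivity), inv_inv]
  have hImono : ∀ s t, s ≤ t → t ≤ 1 → I s ≤ I t := fun s t hst ht =>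
    setIntegral_mono_on (hint s (hst.trans ht)) (hint t ht) measurableSet_Ioi fun l hl =>
      mul_le_mul_of_nonneg_left (hle l hl s t hst ht) (corrWeight_pos β hl).le
  have hIpos : ∀ s ≤ 1, 0 < I s := fun s hs => setIntegral_Ioi_pos (hint s hs) fun l hl => by
    have hl0 : (0 : ℝ) < l := hl
    have h3 : 0 < (1 + l)⁻¹ := by positivity
    exact mul_pos (corrWeight_pos β hl) (Real.rpow_pos_of_pos (h3.trans_le (hbase l hl s hs)) _)
  have hpos : ∀ ρ σ : ℝ, 0 ≤ ρ → ρ < σ → σ ≤ 1 → ρ * I (ρ ^ 2) < σ * I (σ ^ 2) :=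
    fun ρ σ h0 h1 h2 => by
    have hσ : σ ^ 2 ≤ 1 := by nlinarith
    exact (mul_le_mul_of_nonneg_left (hImono (ρ ^ 2) (σ ^ 2) (by nlinarith) hσ) h0).trans_lt
      (mul_lt_mul_of_pos_right h1 (hIpos _ hσ))
  intro ρ hρ σ hσ hlt
  rw [hf ρ (abs_le.mpr hρ), hf σ (abs_le.mpr hσ)]
  refine div_lt_div_of_pos_right ?_ hK
  rcases le_or_gt 0 ρ with h | h
  · exact hpos ρ σ h hlt hσ.2
  rcases le_or_gt σ 0 with h' | h'
  · have := hpos (-σ) (-ρ) (by linarith) (by linarith) (by linarith [hρ.1])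
    simp only [neg_sq] at this
    linarith
  · have h1 := hIpos (ρ ^ 2) (by nlinarith [hρ.1])
    have h2 := hIpos (σ ^ 2) (by nlinarith [hσ.2])
    nlinarith [mul_pos (neg_pos.mpr h) h1, mul_pos h' h2]

theorem mainTheorem3 (pstar q : ℝ) (hp1 : 1 ≤ pstar) (hp2 : pstar < 2)
    (hq1 : 1 ≤ q) (hq2 : q < 2) :
    StrictMonoOn (normHolderCorr (pstar - 1) (q - 1)) (Set.Icc (-1) 1) ∧
    (∀ᶠ y in nhds (0 : ℝ), y ∈ normHolderCorr (pstar - 1) (q - 1) '' Set.Icc (-1) 1) ∧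
    AnalyticAt ℝ (normHolderCorrInv (pstar - 1) (q - 1)) 0 ∧
    ∃ ε : ℝ, 0 < ε ∧ ∀ k : ℕ, 1 ≤ k →
      |invTaylorCoeff (pstar - 1) (q - 1) k| ≤ 6.1831 / ((k : ℝ) * (1 + ε) ^ k) := by
  obtain ⟨α, hα⟩ : ∃ α : ℝ, pstar - 1 = 1 - 2 * α := ⟨(2 - pstar) / 2, by ring⟩
  obtain ⟨β, hb⟩ : ∃ β : ℝ, q - 1 = 1 - 2 * β := ⟨(2 - q) / 2, by ring⟩
  have ha0 : 0 ≤ pstar - 1 := by linarith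
  have hα0 : 0 < α := by linarith
  have hα' : α ≤ 1 / 2 := by linarith
  have hβ : 0 < β := by linarith
  have hβ' : β ≤ 1 / 2 := by linarith
  generalize pstar - 1 = a at *
  generalize q - 1 = b at *
  have hmono := strictMonoOn_normHolderCorr ha0 hα0 hα hβ hβ' hb
  have hext : ∀ x : ℝ, |x| ≤ 1 → corrExt α β x = (normHolderCorr a b x : ℂ) := fun x hx => by
    rw [corrExt_ofReal α β hx, normHolderCorr_eq ha0 (by linarith) hα hβ hβ' hb hx]
    rfl
  obtain ⟨R, G, hR1, hR2, hG, hG'⟩ := exists_inverse_corrExt hα0 hα' hβ hβ'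
  have hball : ∀ y : ℝ, (y : ℂ) ∈ Metric.ball (0 : ℂ) R → ∃ x ∈ Icc (-1 : ℝ) 1,
      (x : ℂ) = G y ∧ normHolderCorr a b x = y := fun y hy => by
    obtain ⟨hD, hFy⟩ := hG y hy
    -- Conjugation symmetry and injectivity make `G` real at real points; lying in the cut plane,
    -- its value is then in `(-1, 1)`.
    have hreal : (starRingEnd ℂ) (G y) = G y := by
      refine injOn_corrExt hα0 hα' hβ hβ' (conj_mem_doublySlitPlane hD) hD ?_
      rw [corrExt_conj α β hD, hFy, Complex.conj_ofReal]
    have hx : |(G y).re| < 1 := hD.resolve_left (not_not.mpr (Complex.conj_eq_iff_im.mp hreal))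
    have hxG : ((G y).re : ℂ) = G y := Complex.conj_eq_iff_re.mp hreal
    refine ⟨(G y).re, abs_le.mp hx.le, hxG, ?_⟩
    have := hext _ hx.le
    rw [hxG, hFy] at this
    exact_mod_cast this.symm
  have hinv : ∀ y : ℝ, (y : ℂ) ∈ Metric.ball (0 : ℂ) R → (normHolderCorrInv a b y : ℂ) = G y :=
    fun y hy => by
    obtain ⟨x, hx, hxG, hxy⟩ := hball y hy
    have hmem : ∃ x ∈ Icc (-1 : ℝ) 1, normHolderCorr a b x = y := ⟨x, hx, hxy⟩
    rw [← hxG]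
    congr 1
    exact hmono.injOn (Function.invFunOn_mem hmem) hx ((Function.invFunOn_eq hmem).trans hxy.symm)
  have h0 : ((0 : ℝ) : ℂ) ∈ Metric.ball (0 : ℂ) R := by simp; linarith
  have hev : ∀ᶠ y : ℝ in nhds 0, (y : ℂ) ∈ Metric.ball (0 : ℂ) R :=
    Complex.continuous_ofReal.continuousAt.eventually_mem (Metric.isOpen_ball.mem_nhds h0)
  have hdiff : DifferentiableOn ℂ G (Metric.ball 0 R) := fun w hw => by
    obtain ⟨g', hg, -⟩ := hG' w hw
    exact hg.differentiableAt.differentiableWithinAt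
  -- Any `ε` with `1 + ε < R` would do: the closed disc of that radius must lie in the domain of
  -- `G`.
  refine ⟨hmono, ?_, ?_, (R - 1) / 2, by linarith, fun k hk => ?_⟩
  · filter_upwards [hev] with y hy
    obtain ⟨x, hx, -, hxy⟩ := hball y hy
    exact ⟨x, hx, hxy⟩
  · have h1 : AnalyticAt ℂ G ((0 : ℝ) : ℂ) := hdiff.analyticAt (Metric.isOpen_ball.mem_nhds h0)
    have h2 : AnalyticAt ℝ (fun y : ℝ => (G y).re) 0 :=
      (Complex.reCLM.analyticAt _).comp
        (h1.restrictScalars.comp (Complex.ofRealCLM.analyticAt 0))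
    refine h2.congr ?_
    filter_upwards [hev] with y hy
    rw [← hinv y hy, Complex.ofReal_re]
  · obtain ⟨n, rfl⟩ : ∃ n, k = n + 1 := ⟨k - 1, by omega⟩
    set r := 1 + (R - 1) / 2 with hr
    have hr0 : 0 < r := by linarith
    have hrR : r < R := by linarith
    have hcl : Metric.closedBall (0 : ℂ) r ⊆ Metric.ball 0 R := Metric.closedBall_subset_ball hrR
    have hcauchy := Complex.norm_iteratedDeriv_le_of_forall_mem_sphere_norm_le (F := ℂ) (c := 0)
      (C := 9 / 2) (f := deriv G) n hr0
      ((((hdiff.deriv Metric.isOpen_ball).mono hcl)).diffContOnCl_ball subset_rfl)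
      (fun z hz => by
        obtain ⟨g', hg, hb⟩ := hG' z (hcl (Metric.sphere_subset_closedBall hz))
        rwa [hg.deriv])
    have heq := iteratedDeriv_ofReal_eq Metric.isOpen_ball hdiff hinv (n + 1) 0 h0
    rw [iteratedDeriv_succ' (f := G), Complex.ofReal_zero] at heq
    rw [← heq, Complex.norm_real, Real.norm_eq_abs] at hcauchy
    rw [invTaylorCoeff, abs_div, Nat.abs_cast, div_le_div_iff₀ (by positivity) (by positivity)]
    rw [le_div_iff₀ (by positivity)] at hcauchy
    rw [Nat.factorial_succ, pow_succ]
    push_cast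
    have hn : (0 : ℝ) < n + 1 := by positivity
    have hf : (0 : ℝ) < n.factorial := by positivity
    calc _ = ((n : ℝ) + 1) * (|iteratedDeriv (n + 1) (normHolderCorrInv a b) 0| * r ^ n) * r := by
          ring
      _ ≤ ((n : ℝ) + 1) * (n.factorial * (9 / 2)) * r := by gcongr
      -- With `k = n + 1`, Cauchy for `G'` supplies only `r^n`; the missing factor `r` is absorbed
      -- by `r ≤ 1.06`.
      _ ≤ ((n : ℝ) + 1) * (n.factorial * (9 / 2)) * 1.06 := by gcongr; linarith
      _ ≤ _ := by nlinarith [mul_pos hn hf]
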